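/- **Setting.** A rooted graph $(G,o)$ is a locally finite (finite or infinite) simple graph with node attributes (features, labels) and edge attributes and a root $o$; rooted graphs are considered up to isomorphism, and $B_k(G,o)$ denotes the $k$-hop neighborhood of the root. With $d_{loc}((G_1,o_1),(G_2,o_2)) = 1/(1+\inf\{k: B_k(G_1,o_1)\not\simeq B_k(G_2,o_2)\})$, random finite graphs $G_n$ *converge locally in probability* to a probability measure $\mu$ on rooted graphs if $\mathbb E_{v}[f(G_n,v)\mid G_n]\to\mathbb E_{\mu}[f(G,o)]$ in probability for every bounded measurable $d_{loc}$-continuous $f$, where $v$ is a uniform vertex of $G_n$. A function $f$ is *almost local* at $\mu$ with limit function $\tilde f$ if $\mathbb E_v[f(G_n,v)\mid G_n]\to\mathbb E_\mu[\tilde f(G,o)]$ in probability for every sequence of random finite graphs $G_n$ that converges locally in probability to $\mu$. A family $(f_W)_W$ is *uniformly almost local* if $\sup_W|\mathbb E_v[f_W(G_n,v)\mid G_n]-\mathbb E_\mu[\tilde f_W(G,o)]|\to 0$ in probability for all these sequences. A sampling-based GNN with $L$ layers and coefficients $W\in\mathbb R^p$ consists of maps $\mathrm{AGGREGATE}_\ell$,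 $\mathrm{COMBINE}_\ell$, a loss $\mathcal L$ of the output embedding of a node, and a computational graph sampler $\nu_C$: for a node $v$ of $G$ a random computational graph $c\sim\nu_C(G,v)$ (a finite set of edges of $G$ kept in each layer) is drawn, and, starting from the node features, $h_w^{(\ell+1)}=\mathrm{COMBINE}_\ell(h_w^{(\ell)},\mathrm{AGGREGATE}_\ell\{h_u^{(\ell)}: (w,u) \text{ kept in layer } \ell\})$. Let $\mathcal L(W,(G,v),c)$ be the loss of the output $z_v=h_v^{(L)}$ and $\mathcal L(W,(G,v))=\mathbb E_{c\sim\nu_C(G,v)}\mathcal L(W,(G,v),c)$. The *limit GNN* is the same GNN evaluated at the root of $(G,o)\sim\mu$, and the expected gradient of its loss is $\mathbb E_\mu[\nabla_W\mathcal L(W,(G,o))]$. *Training with the local BFS sampler.* Fix $\eta>0$, subgraph sizes $N_t$ and minibatch sizes $B_t$, and draw $W_0$ from a given probability law. In step $t$, independently of the past, draw $(G,o)\sim\mu$ and let $G_t$ be the breadth-first local neighborhood of size $N_t$ around $o$, that is, the subgraph induced on the first $N_t$ vertices in breadth-first order (the whole component of $o$ if it is smaller); draw $B_t$ independent uniform vertices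 $v_i$ of $G_t$ and, independently, $c_i\sim\nu_C(G_t,v_i)$; put $W_{t+1}=W_t-\eta\,\frac1{B_t}\sum_i\nabla_W\mathcal L(W_t,(G_t,v_i),c_i)$. **Corollary (local BFS sampler).** Assume that (a) $\mathcal L(W,(G,v),c)$ is bounded, and it and its gradient in $W$ are Lipschitz in $W$, with bounds and a Lipschitz constant $C$ that do not depend on $(G,v)$ and $c$; (b) for every $W$, the loss $\mathcal L(W,\cdot)$ of the GNN is almost local at $\mu$, with the loss of the limit GNN as limit function; (c) the breadth-first local neighborhoods of size $N$ of $(G,o)\sim\mu$ converge locally in probability to $\mu$ as $N\to\infty$. Then there are a learning rate $\eta>0$ and a constant $K$ such that for every $\epsilon>0$ there are $N_\epsilon$ and $B_\epsilon$ such that, whenever $N_t\ge N_\epsilon$ and $B_t\ge B_\epsilon$ for all $t$, training reaches the $\epsilon$-neighborhood of the optimal limit GNN in $O(1/\epsilon^2)$ steps (in particular $\tilde O(1/\epsilon^2)$): 1. there is $t\le K/\epsilon^2$ with $\mathbb E_{W_t}\big\|\mathbb E_\mu[\nabla_W\mathcal L(W_t,(G,o))]\big\|\le\epsilon$; 2.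 if in addition the family $(\mathcal L(W,\cdot))_W$ is uniformly almost local (in the loss of the limit GNN), then the random number of steps $\tau=\inf\{t:\|\mathbb E_\mu[\nabla_W\mathcal L(W_t,(G,o))]\|\le\epsilon\}$, which is also the number of subgraph samples used, satisfies $\mathbb E[\tau]\le K/\epsilon^2$. -/

import Mathlib

open MeasureTheory ProbabilityTheory Filter Topology
open scoped NNReal ENNReal

noncomputable section

namespace LocalGNN

/-! ### Rooted graphs with attributes -/

/-- A locally finite rooted graph with node attributes in `X` (input features and labels) and edge
attributes in `A`, on a finite or infinite set of vertices labelled by natural numbers. It need not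
be connected. Two such graphs stand for the same element of the space of rooted graphs when they
are isomorphic; a random element of that space is given through any random labelling. -/
structure RootedGraph (X A : Type*) where
  verts : Set ℕ
  graph : SimpleGraph ℕ
  adj_mem : ∀ u v, graph.Adj u v → u ∈ verts
  locallyFinite : ∀ v, (graph.neighborSet v).Finite
  node : ℕ → X
  edge : ℕ → ℕ → A
  root : ℕ
  root_mem : root ∈ verts

namespace RootedGraph

variable {X A : Type*}

/-- All the data of a rooted graph. -/
def code (g : RootedGraph X A) :
    Set ℕ × SimpleGraph ℕ × (ℕ → X) × (ℕ → ℕ → A) × ℕ :=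
  (g.verts, g.graph, g.node, g.edge, g.root)

instance [MeasurableSpace X] [MeasurableSpace A] : MeasurableSpace (RootedGraph X A) :=
  MeasurableSpace.comap code inferInstance

open Classical in
/-- The same graph, rooted at the vertex `v` (unchanged if `v` is not a vertex). -/
def rerootAt (g : RootedGraph X A) (v : ℕ) : RootedGraph X A :=
  if h : v ∈ g.verts then { g with root := v, root_mem := h } else g

/-- The vertices at most `k` hops away from the root. -/
def ball (g : RootedGraph X A) : ℕ → Set ℕ
  | 0 => {g.root}
  | k + 1 => {v | v ∈ ball g k ∨ ∃ u, u ∈ ball g k ∧ g.graph.Adj u v}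

/-- `B_k(g) ≃ B_k(h)`: the `k`-hop neighbourhoods of the two roots are isomorphic as rooted graphs
with attributes. -/
def BallIso (k : ℕ) (g h : RootedGraph X A) : Prop :=
  ∃ e : g.ball k ≃ h.ball k,
    (∀ u : g.ball k, (u : ℕ) = g.root → (e u : ℕ) = h.root) ∧
    (∀ u : g.ball k, g.node u = h.node (e u)) ∧
    (∀ u v : g.ball k, g.graph.Adj u v ↔ h.graph.Adj (e u) (e v)) ∧
    (∀ u v : g.ball k, g.graph.Adj u v → g.edge u v = h.edge (e u) (e v))

open Classical in
/-- The local distance `1 / (1 + inf {k : B_k(g) ≄ B_k(h)})`, which is `0` if there is no such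
`k`. -/
def dloc (g h : RootedGraph X A) : ℝ :=
  if ∀ k, BallIso k g h then 0 else 1 / (1 + ((sInf {k : ℕ | ¬ BallIso k g h} : ℕ) : ℝ))

/-- Continuity with respect to the local distance. -/
def DLocContinuous (f : RootedGraph X A → ℝ) : Prop :=
  ∀ g, ∀ ε > 0, ∃ δ > 0, ∀ h, dloc g h < δ → |f h - f g| < ε

/-! ### Breadth-first neighbourhoods -/

/-- `u` comes before `v` in breadth-first order: it is fewer hops away from the root, or equally
far with a smaller label. The labels play no other role, so that any rule for breaking ties (for
example the order in which a queue discovers the vertices) is given by a suitable labelling. -/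
def Before (g : RootedGraph X A) (u v : ℕ) : Prop :=
  (∃ k, u ∈ g.ball k ∧ v ∉ g.ball k) ∨ ((∀ k, u ∈ g.ball k ↔ v ∈ g.ball k) ∧ u < v)

/-- The first `N` vertices of the component of the root in breadth-first order (all of it, if it
has fewer than `N` vertices). The root is always kept, which matters for `N = 0` only. -/
def bfsSet (N : ℕ) (g : RootedGraph X A) : Set ℕ :=
  {v | v = g.root ∨ ((∃ k, v ∈ g.ball k) ∧ {u | g.Before u v}.encard < (N : ℕ∞))}

/-- The breadth-first local neighbourhood of size `N` around the root: the subgraph induced on the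
first `N` vertices, with the attributes of the original graph. -/
def bfs (N : ℕ) (g : RootedGraph X A) : RootedGraph X A where
  verts := g.bfsSet N
  graph :=
    { Adj := fun u v => u ∈ g.bfsSet N ∧ v ∈ g.bfsSet N ∧ g.graph.Adj u v
      symm := ⟨fun _ _ h => ⟨h.2.1, h.1, h.2.2.symm⟩⟩
      loopless := ⟨fun v h => g.graph.loopless.irrefl v h.2.2⟩ }
  adj_mem := fun _ _ h => h.1
  locallyFinite := fun v => (g.locallyFinite v).subset fun _ h => h.2.2
  node := g.node
  edge := g.edge
  root := g.root
  root_mem := Or.inl rfl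

variable [MeasurableSpace X] [MeasurableSpace A]

theorem measurable_code : Measurable (code : RootedGraph X A → _) := comap_measurable _

theorem measurable_verts : Measurable (verts : RootedGraph X A → _) :=
  measurable_fst.comp measurable_code

theorem measurable_graph : Measurable (graph : RootedGraph X A → _) :=
  (measurable_fst.comp measurable_snd).comp measurable_code

theorem measurable_node : Measurable (node : RootedGraph X A → _) :=
  (measurable_fst.comp (measurable_snd.comp measurable_snd)).comp measurable_code

theorem measurable_edge : Measurable (edge : RootedGraph X A → _) :=
  (measurable_fst.comp (measurable_snd.comp (measurable_snd.comp measurable_snd))).comp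
    measurable_code

theorem measurable_root : Measurable (root : RootedGraph X A → _) :=
  (measurable_snd.comp (measurable_snd.comp (measurable_snd.comp measurable_snd))).comp
    measurable_code

theorem measurable_of {Ω : Type*} [MeasurableSpace Ω] {F : Ω → RootedGraph X A}
    (h1 : Measurable fun ω => (F ω).verts) (h2 : Measurable fun ω => (F ω).graph)
    (h3 : Measurable fun ω => (F ω).node) (h4 : Measurable fun ω => (F ω).edge)
    (h5 : Measurable fun ω => (F ω).root) : Measurable F :=
  measurable_comap_iff.2 (h1.prodMk (h2.prodMk (h3.prodMk (h4.prodMk h5))))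

theorem measurable_adj (u v : ℕ) : Measurable fun g : RootedGraph X A => g.graph.Adj u v :=
  SimpleGraph.measurable_iff_adj.1 measurable_graph u v

theorem measurable_mem_ball (k v : ℕ) : Measurable fun g : RootedGraph X A => v ∈ g.ball k := by
  induction k generalizing v with
  | zero =>
    have : Measurable fun g : RootedGraph X A => v = g.root :=
      (Measurable.of_discrete (f := fun r : ℕ => v = r)).comp measurable_root
    simpa [ball] using this
  | succ k ih =>
    have : Measurable fun g : RootedGraph X A =>
        v ∈ g.ball k ∨ ∃ u, u ∈ g.ball k ∧ g.graph.Adj u v :=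
      (ih v).or (Measurable.exists fun u => (ih u).and (measurable_adj u v))
    simpa [ball] using this

theorem measurable_before (u v : ℕ) : Measurable fun g : RootedGraph X A => g.Before u v := by
  unfold Before
  refine Measurable.or (Measurable.exists fun k => ?_) (Measurable.and ?_ measurable_const)
  · exact (measurable_mem_ball k u).and (measurable_mem_ball k v).not
  · exact Measurable.forall fun k => (measurable_mem_ball k u).iff (measurable_mem_ball k v)

theorem encard_lt_iff (S : Set ℕ) (N : ℕ) :
    S.encard < (N : ℕ∞) ↔ ¬ ∃ s : Finset ℕ, s.card = N ∧ ∀ u ∈ s, u ∈ S := by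
  rw [← not_le, not_iff_not]
  constructor
  · intro h
    obtain ⟨t, ht, hc⟩ := Set.exists_subset_encard_eq h
    have hf : t.Finite := Set.finite_of_encard_eq_coe hc
    refine ⟨hf.toFinset, ?_, fun u hu => ht (by simpa using hu)⟩
    rw [hf.encard_eq_coe_toFinset_card] at hc
    exact_mod_cast hc
  · rintro ⟨s, hs, h⟩
    have : (s : Set ℕ).encard ≤ S.encard := Set.encard_le_encard fun u hu => h u (by simpa using hu)
    rwa [Set.encard_coe_eq_coe_finsetCard, hs] at this

theorem measurable_mem_bfsSet (N v : ℕ) :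
    Measurable fun g : RootedGraph X A => v ∈ g.bfsSet N := by
  have h0 : Measurable fun g : RootedGraph X A => v = g.root :=
    (Measurable.of_discrete (f := fun r : ℕ => v = r)).comp measurable_root
  have h1 : Measurable fun g : RootedGraph X A =>
      v = g.root ∨ ((∃ k, v ∈ g.ball k) ∧
        ¬ ∃ s : Finset ℕ, s.card = N ∧ ∀ u ∈ s, g.Before u v) := by
    refine h0.or ((Measurable.exists fun k => measurable_mem_ball k v).and ?_)
    refine (Measurable.exists fun s => measurable_const.and ?_).not
    exact Measurable.forall fun u => measurable_const.imp (measurable_before u v)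
  convert h1 using 3
  simp only [bfsSet, Set.mem_ofPred_eq, encard_lt_iff]

theorem measurable_bfs (N : ℕ) : Measurable (bfs N : RootedGraph X A → RootedGraph X A) := by
  refine measurable_of ?_ ?_ measurable_node measurable_edge measurable_root
  · exact measurable_set_iff.2 fun v => measurable_mem_bfsSet N v
  · refine SimpleGraph.measurable_iff_adj.2 fun u v => ?_
    exact (measurable_mem_bfsSet N u).and ((measurable_mem_bfsSet N v).and (measurable_adj u v))

theorem measurable_rerootAt (v : ℕ) :
    Measurable fun g : RootedGraph X A => g.rerootAt v := by
  have hv : MeasurableSet {g : RootedGraph X A | v ∈ g.verts} :=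
    measurableSet_setOfPred.2 (measurable_set_iff.1 measurable_verts v)
  have e1 : ∀ g : RootedGraph X A, (g.rerootAt v).verts = g.verts := fun g => by
    unfold rerootAt; split_ifs <;> rfl
  have e2 : ∀ g : RootedGraph X A, (g.rerootAt v).graph = g.graph := fun g => by
    unfold rerootAt; split_ifs <;> rfl
  have e3 : ∀ g : RootedGraph X A, (g.rerootAt v).node = g.node := fun g => by
    unfold rerootAt; split_ifs <;> rfl
  have e4 : ∀ g : RootedGraph X A, (g.rerootAt v).edge = g.edge := fun g => by
    unfold rerootAt; split_ifs <;> rfl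
  classical
  have e5 : ∀ g : RootedGraph X A,
      (g.rerootAt v).root = if v ∈ g.verts then v else g.root := fun g => by
    unfold rerootAt; split_ifs <;> rfl
  refine measurable_of ?_ ?_ ?_ ?_ ?_
  · simpa only [e1] using measurable_verts
  · simpa only [e2] using measurable_graph
  · simpa only [e3] using measurable_node
  · simpa only [e4] using measurable_edge
  · simp only [e5]
    exact Measurable.ite hv measurable_const measurable_root

end RootedGraph

open RootedGraph

variable {X A : Type*} [MeasurableSpace X] [MeasurableSpace A]

/-! ### Local convergence and almost local functions -/

/-- The expectation of `f (g, v)` over a uniformly random vertex `v` of the finite graph `g`. -/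
def nodeAvg (f : RootedGraph X A → ℝ) (g : RootedGraph X A) : ℝ :=
  ∫ v, f (g.rerootAt v) ∂(uniformOn g.verts)

/-- Local convergence in probability of random finite graphs `G_n ∼ ρ n` (whose own roots are
ignored) to the limit graph `(G, o) ∼ μ`. -/
def LocallyConverges (ρ : ℕ → Measure (RootedGraph X A)) (μ : Measure (RootedGraph X A)) : Prop :=
  ∀ f : RootedGraph X A → ℝ, Measurable f → (∃ b, ∀ g, |f g| ≤ b) → DLocContinuous f →
    ∀ ε > 0, Tendsto (fun n => ρ n {g | ε ≤ |nodeAvg f g - ∫ h, f h ∂μ|}) atTop (𝓝 0)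

/-- The functions `f i` are almost local at `μ`, uniformly in `i`, with limit functions `flim i`:
along every sequence of random finite graphs that converges locally in probability to `μ`, the
averages of `f i` over a uniformly random vertex converge in probability to the expectation of
`flim i` under `μ`, uniformly in `i`. -/
def UniformlyAlmostLocal {ι : Type*} (μ : Measure (RootedGraph X A))
    (f flim : ι → RootedGraph X A → ℝ) : Prop :=
  ∀ ρ : ℕ → Measure (RootedGraph X A), (∀ n, IsProbabilityMeasure (ρ n)) →
    (∀ n, ∀ᵐ g ∂(ρ n), g.verts.Finite) → LocallyConverges ρ μ →
    ∀ ε > 0, Tendsto (fun n => ρ n {g | ∃ i, ε ≤ |nodeAvg (f i) g - ∫ h, flim i h ∂μ|})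
      atTop (𝓝 0)

/-- The function `f` is almost local at `μ`, with limit function `flim`. -/
def AlmostLocal (μ : Measure (RootedGraph X A)) (f flim : RootedGraph X A → ℝ) : Prop :=
  UniformlyAlmostLocal μ (fun _ : Unit => f) (fun _ : Unit => flim)

/-! ### Sampling-based graph neural networks -/

/-- A vector of `p` learnable coefficients. -/
abbrev Coeffs (p : ℕ) := EuclideanSpace ℝ (Fin p)

/-- A computational graph: the triple `(ℓ, v, u)` belongs to it when the embedding of the neighbour
`u` is kept in the aggregation at the node `v` in layer `ℓ`. -/
abbrev CompGraph := Finset (ℕ × ℕ × ℕ)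

/-- Only edges of `g` are used. -/
def CompGraph.IsIn (c : CompGraph) (g : RootedGraph X A) : Prop :=
  ∀ e ∈ c, g.graph.Adj e.2.1 e.2.2

/-- A sampling-based GNN with `depth` layers and `p` learnable coefficients. The aggregation and
combination maps at a node `v` and the loss at `v` may depend on the rooted graph `(G, v)`, as
for normalised aggregation, labels, regularisation, or negative sampling. All components are
also defined on infinite graphs, where they are those of the limit GNN. -/
structure SamplingGNN (X A : Type*) [MeasurableSpace X] [MeasurableSpace A] (p : ℕ) where
  depth : ℕ
  dim : ℕ → ℕ
  aggDim : ℕ → ℕ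
  feature : X → EuclideanSpace ℝ (Fin (dim 0))
  aggregate : (l : ℕ) → Coeffs p → RootedGraph X A →
    Multiset (A × EuclideanSpace ℝ (Fin (dim l))) → EuclideanSpace ℝ (Fin (aggDim l))
  combine : (l : ℕ) → Coeffs p → RootedGraph X A →
    EuclideanSpace ℝ (Fin (dim l)) → EuclideanSpace ℝ (Fin (aggDim l)) →
      EuclideanSpace ℝ (Fin (dim (l + 1)))
  loss : Coeffs p → RootedGraph X A → EuclideanSpace ℝ (Fin (dim depth)) → ℝ
  /-- The law of the computational graph sampled at the root. -/
  sampler : Kernel (RootedGraph X A) CompGraph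
  sampler_markov : IsMarkovKernel sampler
  sampler_isIn : ∀ g, ∀ᵐ c ∂(sampler g), CompGraph.IsIn c g

instance {p : ℕ} (M : SamplingGNN X A p) : IsMarkovKernel M.sampler := M.sampler_markov

namespace SamplingGNN

variable {p : ℕ} (M : SamplingGNN X A p)

/-- The embedding of the node `v` in layer `l`, propagated along the computational graph `c`. -/
def embed (W : Coeffs p) (g : RootedGraph X A) (c : CompGraph) :
    (l : ℕ) → ℕ → EuclideanSpace ℝ (Fin (M.dim l))
  | 0, v => M.feature (g.node v)
  | l + 1, v =>
    M.combine l W (g.rerootAt v) (embed W g c l v)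
      (M.aggregate l W (g.rerootAt v)
        ((c.filter fun e => e.1 = l ∧ e.2.1 = v).val.map
          fun e => (g.edge v e.2.2, embed W g c l e.2.2)))

/-- The loss of the output embedding of the root, computed along the computational graph `c`. -/
def nodeLoss (W : Coeffs p) (g : RootedGraph X A) (c : CompGraph) : ℝ :=
  M.loss W g (M.embed W g c M.depth g.root)

/-- The loss at the root, in expectation over the computational graph sampler. -/
def expectedLoss (W : Coeffs p) (g : RootedGraph X A) : ℝ :=
  ∫ c, M.nodeLoss W g c ∂(M.sampler g)

/-- The gradient of the loss at the root in the coefficients. -/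
def nodeGrad (W : Coeffs p) (g : RootedGraph X A) (c : CompGraph) : Coeffs p :=
  gradient (fun W' => M.nodeLoss W' g c) W

/-- The expected gradient of the loss of the GNN on the limit graph `(G, o) ∼ μ`. -/
def limitGrad (μ : Measure (RootedGraph X A)) (W : Coeffs p) : Coeffs p :=
  ∫ g, ∫ c, M.nodeGrad W g c ∂(M.sampler g) ∂μ

/-- The loss is bounded by `b`, and the loss and its gradient are Lipschitz in the coefficients
with constant `C`. -/
structure RegularLoss (b : ℝ) (C : ℝ≥0) : Prop where
  bounded : ∀ W g c, CompGraph.IsIn c g → |M.nodeLoss W g c| ≤ b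
  differentiable : ∀ g c, CompGraph.IsIn c g → Differentiable ℝ fun W => M.nodeLoss W g c
  lipschitz : ∀ g c, CompGraph.IsIn c g → LipschitzWith C fun W => M.nodeLoss W g c
  lipschitz_grad : ∀ g c, CompGraph.IsIn c g → LipschitzWith C fun W => M.nodeGrad W g c

end SamplingGNN

/-! ### Training on sampled subgraphs -/

theorem measurable_uniformOn : Measurable fun s : Set ℕ => (uniformOn s : Measure ℕ) := by
  have hc : ∀ t : Set ℕ, Measurable fun s : Set ℕ => (Measure.count (s ∩ t) : ℝ≥0∞) := by
    intro t
    have : ∀ s : Set ℕ, (Measure.count (s ∩ t) : ℝ≥0∞) = ∑' i, (s ∩ t).indicator 1 i := by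
      intro s
      rw [Measure.count_apply (Set.to_countable _).measurableSet, ← ENNReal.tsum_set_one]
      exact tsum_subtype (s ∩ t) 1
    simp only [this]
    refine Measurable.tsum fun i => ?_
    by_cases hi : i ∈ t
    · have hm : MeasurableSet {s : Set ℕ | i ∈ s} := measurableSet_mem i
      have : (fun s : Set ℕ => (s ∩ t).indicator (1 : ℕ → ℝ≥0∞) i)
          = Set.indicator {s : Set ℕ | i ∈ s} 1 := by
        ext s; by_cases h : i ∈ s <;> simp [h, hi]
      rw [this]
      exact measurable_one.indicator hm
    · simp [hi]
  refine Measure.measurable_of_measurable_coe _ fun t ht => ?_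
  have : ∀ s : Set ℕ, uniformOn s t
      = (Measure.count (s ∩ Set.univ) : ℝ≥0∞)⁻¹ * Measure.count (s ∩ t) := by
    intro s
    rw [uniformOn, cond_apply (Set.to_countable _).measurableSet, Set.inter_univ]
  simp only [this]
  exact (hc _).inv.mul (hc t)

/-- The uniform node sampler on finite graphs. -/
def uniformNode : Kernel (RootedGraph X A) ℕ where
  toFun g := uniformOn g.verts
  measurable' := measurable_uniformOn.comp measurable_verts

instance : IsFiniteKernel (uniformNode : Kernel (RootedGraph X A) ℕ) :=
  ⟨1, ENNReal.one_lt_top, fun g => by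
    change uniformOn g.verts Set.univ ≤ 1
    exact prob_le_one⟩

/-- One draw of a uniformly random node and of a computational graph for that node. -/
def nodeDraw {p : ℕ} (M : SamplingGNN X A p) : Kernel (RootedGraph X A) (ℕ × CompGraph) :=
  uniformNode ⊗ₖ (M.sampler.comap (fun q : RootedGraph X A × ℕ => q.1.rerootAt q.2)
    (measurable_from_prod_countable_left fun v => measurable_rerootAt v))

instance {p : ℕ} (M : SamplingGNN X A p) : IsFiniteKernel (nodeDraw M) := by
  unfold nodeDraw; infer_instance

/-- A minibatch of `B` independent draws of a node and of its computational graph. -/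
def batchDraw {p : ℕ} (M : SamplingGNN X A p) (B : ℕ) :
    Kernel (RootedGraph X A) (Fin B → ℕ × CompGraph) where
  toFun g := Measure.pi fun _ : Fin B => nodeDraw M g
  measurable' := by
    refine Measure.measurable_of_measurable_coe _ fun t ht => ?_
    have : ∀ g : RootedGraph X A, (Measure.pi fun _ : Fin B => nodeDraw M g) t
        = ∑' x : t, ∏ i, nodeDraw M g {(x : Fin B → ℕ × CompGraph) i} := by
      intro g
      rw [← Measure.tsum_indicator_apply_singleton _ t ht, ← tsum_subtype]
      simp
    simp only [this]
    refine Measurable.tsum fun x => Finset.measurable_prod _ fun i _ => ?_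
    exact Kernel.measurable_coe _ (measurableSet_singleton _)

instance {p : ℕ} (M : SamplingGNN X A p) (B : ℕ) : IsFiniteKernel (batchDraw M B) :=
  ⟨1, ENNReal.one_lt_top, fun g => by
    change (Measure.pi fun _ : Fin B => nodeDraw M g) Set.univ ≤ 1
    rw [Measure.pi_univ]
    refine Finset.prod_le_one' fun i _ => ?_
    have h : nodeDraw M g Set.univ = uniformOn g.verts Set.univ := by
      rw [nodeDraw, Kernel.compProd_apply MeasurableSet.univ]
      simp [uniformNode]
    rw [h]
    exact prob_le_one⟩

/-- The random data of a training step: a subgraph `G_t`, and a minibatch of nodes of `G_t`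
with computational graphs. -/
abbrev StepSample (X A : Type*) (B : ℕ) := RootedGraph X A × (Fin B → ℕ × CompGraph)

/-- The law of the data of a training step: `(G, o) ∼ μ` is drawn, `G_t` is its breadth-first local
neighbourhood of size `N`, and the minibatch is drawn from `G_t`. -/
def stepLaw {p : ℕ} (M : SamplingGNN X A p) (μ : Measure (RootedGraph X A)) (N B : ℕ) :
    Measure (StepSample X A B) :=
  (μ.map (bfs N)) ⊗ₘ batchDraw M B

/-- The minibatch estimate of the gradient of the loss (node weights are `1`, as the node sampler is
uniform). -/
def batchGrad {p : ℕ} (M : SamplingGNN X A p) {B : ℕ} (W : Coeffs p) (s : StepSample X A B) :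
    Coeffs p :=
  (B : ℝ)⁻¹ • ∑ i, M.nodeGrad W (s.1.rerootAt (s.2 i).1) (s.2 i).2

/-- A run of the training algorithm with learning rate `η` and with the local breadth-first
subgraph sampler, using subgraphs of size `N t` and minibatches of size `B t` in step `t`, on a
probability space `(Ω, P)`. The initial coefficients `W 0` have law `ν`, and the data of the steps
are independent of each other and of `W 0`. -/
structure TrainingRun {p : ℕ} (M : SamplingGNN X A p) (μ : Measure (RootedGraph X A))
    (ν : Measure (Coeffs p)) (η : ℝ) (N B : ℕ → ℕ)
    {Ω : Type*} [MeasurableSpace Ω] (P : Measure Ω) where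
  W : ℕ → Ω → Coeffs p
  sample : (t : ℕ) → Ω → StepSample X A (B t)
  law_init : HasLaw (W 0) ν P
  law_sample : ∀ t, HasLaw (sample t) (stepLaw M μ (N t) (B t)) P
  indep_samples : iIndepFun sample P
  indep_init : IndepFun (W 0) (fun ω t => sample t ω) P
  update : ∀ t ω, W (t + 1) ω = W t ω - η • batchGrad M (W t ω) (sample t ω)

/-- The number of training steps until the expected gradient of the loss in the limit is at most
`ε` (infinite if this never happens). -/
def trainingTime {p : ℕ} (M : SamplingGNN X A p) (μ : Measure (RootedGraph X A)) (ε : ℝ)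
    {Ω : Type*} (W : ℕ → Ω → Coeffs p) (ω : Ω) : ℝ≥0∞ :=
  ⨅ (t : ℕ) (_ : ‖M.limitGrad μ (W t ω)‖ ≤ ε), (t : ℝ≥0∞)

end LocalGNN

end

open LocalGNN

/-!
The argument is the analysis of gradient descent with an inexact gradient: a gradient step along
*any* estimate `ĝ` of the gradient of a smooth objective decreases the objective by
`η / 2 · ‖∇‖²` up to `η / 2 · ‖ĝ - ∇‖²` (`descent_step`). The objective here is the expected loss
of the limit GNN, and it is bounded, so gradients of norm more than `ε` cannot persist for more than
`O(1 / ε²)` steps as soon as the mean squared error of the minibatch gradient is at most `ε² / 2`.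
This gives the step count in mean (`MeasurableRun.exists_integral_norm_limitGrad_le`), and, applied
on the events that the training has not ended yet, the mean of the training time
(`MeasurableRun.lintegral_trainingTime_le`).

The mean squared error splits into the variance of the minibatch, of order `1 / B`
(`integral_norm_average_sub_sq_le`), and the distance between the mean gradient over the nodes of the
subgraph and the limit gradient. Almost locality speaks of losses, not of gradients, but functions
with Lipschitz gradients that are uniformly close near a point have close gradients at this point
(`SmoothFamily.norm_integral_grad_sub_sq_le`). The first-order expansions with quadratic error that
this and the descent need pass to averages directly, so that nothing is ever differentiated under an
integral. Together this bounds the error uniformly on every set of coefficients near which the losses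
converge uniformly (`exists_integral_error_le`).

Under uniform almost locality this set is the whole space. Under almost locality for each `W` it is a
ball, by a finite net and the Lipschitz property (`tendsto_lossGap_of_isCompact`), and a run of
deterministic length stays in a ball with high probability because its steps are bounded and the law
of `W 0` is tight. A state of the run is independent of the sample drawn next, so that the bounds
for fixed coefficients apply along the run (`setIntegral_le_of_stays`).
-/

namespace LocalGNN

/-! ### Averages of smooth functions of the coefficients -/

/-- A differentiable function with a `C`-Lipschitz gradient differs from its first-order expansion
by at most `C ‖h‖²`. -/
theorem abs_sub_sub_inner_gradient_le {E : Type*} [NormedAddCommGroup E] [InnerProductSpace ℝ E]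
    [CompleteSpace E] {f : E → ℝ} {C : ℝ≥0} (hf : Differentiable ℝ f)
    (hL : LipschitzWith C (gradient f)) (x h : E) :
    |f (x + h) - f x - inner ℝ (gradient f x) h| ≤ C * ‖h‖ ^ 2 := by
  have hgrad : ∀ y, HasFDerivAt f (InnerProductSpace.toDual ℝ E (gradient f y)) y := fun y =>
    (hf y).hasGradientAt.hasFDerivAt
  have key := (convex_segment x (x + h)).norm_image_sub_le_of_norm_hasFDerivWithin_le'
    (f := f) (f' := fun y => InnerProductSpace.toDual ℝ E (gradient f y))
    (φ := InnerProductSpace.toDual ℝ E (gradient f x)) (C := C * ‖h‖)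
    (fun y _ => (hgrad y).hasFDerivWithinAt) ?_ (left_mem_segment ℝ x (x + h))
    (right_mem_segment ℝ x (x + h))
  · simpa [InnerProductSpace.toDual_apply_apply, sq, mul_assoc] using key
  · intro y hy
    rw [← map_sub, LinearIsometryEquiv.norm_map]
    refine (hL.norm_sub_le y x).trans ?_
    gcongr
    simpa using norm_sub_le_of_mem_segment hy

/-- A family of functions `ℓ · z` of the coefficients with gradients `γ · z`, measurable in `z`: the
functions are bounded by `b`, they and their gradients are Lipschitz with constant `C`, and so the
first-order expansions have a quadratic error. Only these consequences of differentiability enter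
the arguments, and all of them are inherited by averages over `z`. -/
structure SmoothFamily {Z E : Type*} [MeasurableSpace Z] [NormedAddCommGroup E]
    [InnerProductSpace ℝ E] [MeasurableSpace E]
    (ℓ : E → Z → ℝ) (γ : E → Z → E) (b C : ℝ) : Prop where
  measurable_loss : ∀ W, Measurable (ℓ W)
  measurable_grad : ∀ W, Measurable (γ W)
  abs_loss_le : ∀ W z, |ℓ W z| ≤ b
  norm_grad_le : ∀ W z, ‖γ W z‖ ≤ C
  lipschitz_loss : ∀ W W' z, |ℓ W z - ℓ W' z| ≤ C * ‖W - W'‖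
  lipschitz_grad : ∀ W W' z, ‖γ W z - γ W' z‖ ≤ C * ‖W - W'‖
  expansion : ∀ W h z, |ℓ (W + h) z - ℓ W z - inner ℝ (γ W z) h| ≤ C * ‖h‖ ^ 2

theorem norm_integral_le_of_forall_le {Z F : Type*} [MeasurableSpace Z] [NormedAddCommGroup F]
    [NormedSpace ℝ F] (q : Measure Z) [IsZeroOrProbabilityMeasure q] {f : Z → F} {c : ℝ}
    (hc : 0 ≤ c) (h : ∀ z, ‖f z‖ ≤ c) : ‖∫ z, f z ∂q‖ ≤ c := by
  refine (norm_integral_le_of_norm_le_const (ae_of_all q h)).trans ?_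
  exact mul_le_of_le_one_right hc measureReal_le_one

namespace SmoothFamily

variable {Z E : Type*} [MeasurableSpace Z] [NormedAddCommGroup E] [InnerProductSpace ℝ E]
  [MeasurableSpace E]
  {ℓ : E → Z → ℝ} {γ : E → Z → E} {b C : ℝ}

theorem integrable_loss (S : SmoothFamily ℓ γ b C) (q : Measure Z) [IsZeroOrProbabilityMeasure q]
    (W : E) : Integrable (ℓ W) q :=
  Integrable.of_bound (S.measurable_loss W).aestronglyMeasurable b
    (ae_of_all q fun z => S.abs_loss_le W z)

theorem norm_integral_grad_le (S : SmoothFamily ℓ γ b C) (hC : 0 ≤ C) (q : Measure Z)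
    [IsZeroOrProbabilityMeasure q] (W : E) : ‖∫ z, γ W z ∂q‖ ≤ C :=
  norm_integral_le_of_forall_le q hC (S.norm_grad_le W)

theorem abs_integral_loss_le (S : SmoothFamily ℓ γ b C) (hb : 0 ≤ b) (q : Measure Z)
    [IsZeroOrProbabilityMeasure q] (W : E) : |∫ z, ℓ W z ∂q| ≤ b :=
  norm_integral_le_of_forall_le (F := ℝ) q hb (S.abs_loss_le W)

theorem lipschitz_integral_loss (S : SmoothFamily ℓ γ b C) (hC : 0 ≤ C) (q : Measure Z)
    [IsZeroOrProbabilityMeasure q] (W W' : E) :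
    |∫ z, ℓ W z ∂q - ∫ z, ℓ W' z ∂q| ≤ C * ‖W - W'‖ := by
  rw [← integral_sub (S.integrable_loss q W) (S.integrable_loss q W')]
  exact norm_integral_le_of_forall_le (F := ℝ) q (by positivity) (S.lipschitz_loss W W')

variable [SecondCountableTopology E] [BorelSpace E]

theorem integrable_grad (S : SmoothFamily ℓ γ b C) (q : Measure Z) [IsZeroOrProbabilityMeasure q]
    (W : E) : Integrable (γ W) q :=
  Integrable.of_bound (S.measurable_grad W).aestronglyMeasurable C
    (ae_of_all q fun z => S.norm_grad_le W z)

theorem lipschitz_integral_grad (S : SmoothFamily ℓ γ b C) (hC : 0 ≤ C) (q : Measure Z)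
    [IsZeroOrProbabilityMeasure q] (W W' : E) :
    ‖∫ z, γ W z ∂q - ∫ z, γ W' z ∂q‖ ≤ C * ‖W - W'‖ := by
  rw [← integral_sub (S.integrable_grad q W) (S.integrable_grad q W')]
  exact norm_integral_le_of_forall_le q (by positivity) (S.lipschitz_grad W W')

variable [CompleteSpace E]

theorem expansion_integral (S : SmoothFamily ℓ γ b C) (hC : 0 ≤ C) (q : Measure Z)
    [IsZeroOrProbabilityMeasure q] (W h : E) :
    |∫ z, ℓ (W + h) z ∂q - ∫ z, ℓ W z ∂q - inner ℝ (∫ z, γ W z ∂q) h| ≤ C * ‖h‖ ^ 2 := by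
  have h1 : inner ℝ (∫ z, γ W z ∂q) h = ∫ z, inner ℝ (γ W z) h ∂q := by
    rw [real_inner_comm, ← integral_inner (S.integrable_grad q W) h]
    simp only [real_inner_comm]
  have h2 : Integrable (fun z => inner ℝ (γ W z) h) q := (S.integrable_grad q W).inner_const h
  have h3 : Integrable (fun z => ℓ (W + h) z - ℓ W z) q :=
    (S.integrable_loss q _).sub (S.integrable_loss q W)
  rw [h1, ← integral_sub (S.integrable_loss q _) (S.integrable_loss q W), ← integral_sub h3 h2]
  exact norm_integral_le_of_forall_le (F := ℝ) q (by positivity) (S.expansion W h)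

/-- If two averages of a smooth family are `δ`-close at `W` and at the point reached from `W` by a
gradient step of length `s` for their difference, then their gradients at `W` are close: such a step
changes the difference by about `s` times the squared norm of its gradient. -/
theorem norm_integral_grad_sub_sq_le (S : SmoothFamily ℓ γ b C) (hC : 0 ≤ C) (q q' : Measure Z)
    [IsZeroOrProbabilityMeasure q] [IsZeroOrProbabilityMeasure q'] (W : E) {s δ : ℝ} (hs : 0 < s)
    (h0 : |∫ z, ℓ W z ∂q - ∫ z, ℓ W z ∂q'| ≤ δ)
    (h1 : |∫ z, ℓ (W + (-s) • (∫ z, γ W z ∂q - ∫ z, γ W z ∂q')) z ∂q -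
      ∫ z, ℓ (W + (-s) • (∫ z, γ W z ∂q - ∫ z, γ W z ∂q')) z ∂q'| ≤ δ) :
    ‖∫ z, γ W z ∂q - ∫ z, γ W z ∂q'‖ ^ 2 ≤ 2 * δ / s + 8 * C ^ 3 * s := by
  have e1 := S.expansion_integral hC q W ((-s) • (∫ z, γ W z ∂q - ∫ z, γ W z ∂q'))
  have e2 := S.expansion_integral hC q' W ((-s) • (∫ z, γ W z ∂q - ∫ z, γ W z ∂q'))
  have n1 := S.norm_integral_grad_le hC q W
  have n2 := S.norm_integral_grad_le hC q' W
  have hG : ‖∫ z, γ W z ∂q - ∫ z, γ W z ∂q'‖ ≤ 2 * C := (norm_sub_le _ _).trans (by linarith)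
  have hin : inner ℝ (∫ z, γ W z ∂q) ((-s) • (∫ z, γ W z ∂q - ∫ z, γ W z ∂q')) -
      inner ℝ (∫ z, γ W z ∂q') ((-s) • (∫ z, γ W z ∂q - ∫ z, γ W z ∂q')) =
      -s * ‖∫ z, γ W z ∂q - ∫ z, γ W z ∂q'‖ ^ 2 := by
    rw [← inner_sub_left, inner_smul_right, real_inner_self_eq_norm_sq]
  rw [norm_smul, Real.norm_eq_abs, abs_neg, abs_of_pos hs, mul_pow] at e1 e2
  set G := ∫ z, γ W z ∂q - ∫ z, γ W z ∂q'
  have hG2 : ‖G‖ ^ 2 ≤ 4 * C ^ 2 := by nlinarith [norm_nonneg G]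
  have hmain : s * ‖G‖ ^ 2 ≤ 2 * δ + 2 * C * (s ^ 2 * ‖G‖ ^ 2) := by
    rw [abs_le] at *
    linarith [e1.1, e1.2, e2.1, e2.2, h0.1, h0.2, h1.1, h1.2]
  have h3 : 2 * C * (s ^ 2 * ‖G‖ ^ 2) ≤ 2 * C * (s ^ 2 * (4 * C ^ 2)) := by gcongr
  have : s * ‖G‖ ^ 2 ≤ s * (2 * δ / s + 8 * C ^ 3 * s) := by
    have : s * (2 * δ / s + 8 * C ^ 3 * s) = 2 * δ + 2 * C * (s ^ 2 * (4 * C ^ 2)) := by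
      field_simp; ring
    linarith
  exact le_of_mul_le_mul_left this hs

end SmoothFamily

/-! ### The mean squared error of a minibatch average -/

/-- The mean squared error of an average of `B` independent copies of a vector bounded by `C`,
as an estimate of a vector `a`: the variance of the average contributes `2 C² / B` and the bias
`2 ‖m - a‖²`, where `m` is the mean. -/
theorem integral_norm_average_sub_sq_le {D ι κ : Type*} [MeasurableSpace D] [Fintype ι]
    [Nonempty ι] [Fintype κ] (q : Measure D) [IsProbabilityMeasure q]
    {x : D → EuclideanSpace ℝ κ} (hx : Measurable x) {C : ℝ} (hC : ∀ d, ‖x d‖ ≤ C)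
    (a : EuclideanSpace ℝ κ) :
    ∫ s, ‖(Fintype.card ι : ℝ)⁻¹ • ∑ i, x (s i) - a‖ ^ 2 ∂(Measure.pi fun _ : ι => q) ≤
      2 * C ^ 2 / Fintype.card ι + 2 * ‖∫ d, x d ∂q - a‖ ^ 2 := by
  set n : ℝ := (Fintype.card ι : ℝ) with hn
  have hn0 : 0 < n := by rw [hn]; exact_mod_cast Fintype.card_pos
  have hC0 : 0 ≤ C := by
    obtain ⟨d⟩ := q.nonempty_of_neZero
    exact (norm_nonneg _).trans (hC d)
  set m := ∫ d, x d ∂q with hm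
  set Q := Measure.pi fun _ : ι => q
  have hxk : ∀ k, Measurable fun d => x d k := fun k => by fun_prop
  have hxb : ∀ k d, |x d k| ≤ C := fun k d => (PiLp.norm_apply_le (x d) k).trans (hC d)
  have hxint : Integrable x q := Integrable.of_bound hx.aestronglyMeasurable C (ae_of_all _ hC)
  have hmk : ∀ k, m k = ∫ d, x d k ∂q := fun k => by
    have := ((EuclideanSpace.proj k : EuclideanSpace ℝ κ →L[ℝ] ℝ)).integral_comp_comm hxint
    simpa using this.symm
  have hLp : ∀ k, MemLp (fun d => x d k) 2 q := fun k =>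
    MemLp.of_bound (hxk k).aestronglyMeasurable C (ae_of_all _ (hxb k))
  set y : (ι → D) → EuclideanSpace ℝ κ := fun s => n⁻¹ • ∑ i, x (s i) with hy
  have hymeas : Measurable y := by fun_prop
  have hyC : ∀ s, ‖y s‖ ≤ C := fun s => by
    rw [hy, norm_smul, norm_inv, Real.norm_of_nonneg hn0.le, inv_mul_le_iff₀ hn0]
    refine (norm_sum_le_of_le _ fun i _ => hC (s i)).trans ?_
    simp [hn]
  have hvar : ∀ k, ∫ s, (y s k - m k) ^ 2 ∂Q ≤ n⁻¹ * ∫ d, x d k ^ 2 ∂q := by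
    intro k
    have hmean : ∀ i, ∫ s, x (s i) k ∂Q = m k := fun i => by
      rw [hmk]
      exact integral_comp_eval (μ := fun _ : ι => q) (i := i) (hxk k).aestronglyMeasurable
    have hsint : ∀ i, Integrable (fun s : ι → D => x (s i) k) Q := fun i =>
      Integrable.of_bound ((hxk k).comp (measurable_pi_apply i)).aestronglyMeasurable C
        (ae_of_all _ fun s => hxb k (s i))
    have hyk : (fun s => y s k) = fun s => n⁻¹ * (∑ i, fun s : ι → D => x (s i) k) s := by
      ext s; simp [hy]
    have hEy : ∫ s, y s k ∂Q = m k := by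
      rw [hyk, integral_const_mul]
      simp only [Finset.sum_apply]
      rw [integral_finsetSum _ fun i _ => hsint i]
      simp only [hmean, Finset.sum_const, Finset.card_univ, nsmul_eq_mul]
      field_simp
      exact hn ▸ rfl
    have h1 : ∫ s, (y s k - m k) ^ 2 ∂Q = variance (fun s => y s k) Q := by
      rw [variance_eq_integral (by fun_prop), hEy]
    rw [h1, hyk, variance_const_mul,
      variance_sum_pi (μ := fun _ : ι => q) (X := fun _ d => x d k) (fun _ => hLp k)]
    simp only [Finset.sum_const, Finset.card_univ, nsmul_eq_mul]
    have h2 : variance (fun d => x d k) q ≤ ∫ d, x d k ^ 2 ∂q := by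
      simpa using variance_le_expectation_sq (μ := q) (X := fun d => x d k)
        (hxk k).aestronglyMeasurable
    calc n⁻¹ ^ 2 * (n * variance (fun d => x d k) q) = n⁻¹ * variance (fun d => x d k) q := by
          field_simp
      _ ≤ _ := by gcongr
  have hint : ∀ v, Integrable (fun s => ‖y s - v‖ ^ 2) Q := fun v => by
    refine Integrable.of_bound (by fun_prop) ((C + ‖v‖) ^ 2) (ae_of_all _ fun s => ?_)
    rw [Real.norm_of_nonneg (by positivity)]
    have := (norm_sub_le (y s) v).trans (add_le_add_left (hyC s) _)
    gcongr
  have hV : ∫ s, ‖y s - m‖ ^ 2 ∂Q ≤ C ^ 2 / n := by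
    have hk : ∀ k, Integrable (fun s => (y s k - m k) ^ 2) Q := fun k => by
      refine (hint m).mono (by fun_prop) (ae_of_all _ fun s => ?_)
      rw [Real.norm_of_nonneg (by positivity), Real.norm_of_nonneg (by positivity), ← sq_abs]
      have := PiLp.norm_apply_le (y s - m) k
      rw [PiLp.sub_apply, Real.norm_eq_abs] at this
      gcongr
    have hk' : ∀ k, Integrable (fun d => x d k ^ 2) q := fun k => (hLp k).integrable_sq
    calc ∫ s, ‖y s - m‖ ^ 2 ∂Q = ∑ k, ∫ s, (y s k - m k) ^ 2 ∂Q := by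
          rw [← integral_finsetSum _ fun k _ => hk k]
          simp [EuclideanSpace.norm_sq_eq]
      _ ≤ ∑ k, n⁻¹ * ∫ d, x d k ^ 2 ∂q := Finset.sum_le_sum fun k _ => hvar k
      _ = n⁻¹ * ∫ d, ‖x d‖ ^ 2 ∂q := by
          rw [← Finset.mul_sum, ← integral_finsetSum _ fun k _ => hk' k]
          simp [EuclideanSpace.norm_sq_eq]
      _ ≤ n⁻¹ * C ^ 2 := by
          gcongr
          refine (le_abs_self _).trans
            (norm_integral_le_of_forall_le (F := ℝ) (c := C ^ 2) q (by positivity) fun d => ?_)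
          rw [Real.norm_of_nonneg (by positivity)]
          have := hC d
          gcongr
      _ = C ^ 2 / n := by ring
  have hpt : ∀ s, ‖y s - a‖ ^ 2 ≤ 2 * ‖y s - m‖ ^ 2 + 2 * ‖m - a‖ ^ 2 := fun s => by
    have := norm_sub_le_norm_sub_add_norm_sub (y s) m a
    nlinarith [sq_nonneg (‖y s - m‖ - ‖m - a‖), norm_nonneg (y s - a), norm_nonneg (y s - m),
      norm_nonneg (m - a)]
  calc ∫ s, ‖y s - a‖ ^ 2 ∂Q ≤ ∫ s, (2 * ‖y s - m‖ ^ 2 + 2 * ‖m - a‖ ^ 2) ∂Q :=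
        integral_mono (hint a) (((hint m).const_mul 2).add (integrable_const _)) hpt
    _ = 2 * ∫ s, ‖y s - m‖ ^ 2 ∂Q + 2 * ‖m - a‖ ^ 2 := by
        rw [integral_add ((hint m).const_mul 2) (integrable_const _), integral_const_mul]
        simp
    _ ≤ _ := by
        have : 2 * C ^ 2 / n = 2 * (C ^ 2 / n) := by ring
        linarith

/-! ### Stochastic gradient descent with inexact gradients -/

/-- One gradient step along any estimate `g` of the gradient `v` decreases the objective by
`η / 2 · ‖v‖²`, up to `η / 2` times the squared error of the estimate. The estimate need not be
unbiased. -/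
theorem descent_step {E : Type*} [NormedAddCommGroup E] [InnerProductSpace ℝ E] {F : E → ℝ}
    {W v g : E} {C η : ℝ} (hη : 0 < η) (hCη : C * η ≤ 1 / 2)
    (hF : ∀ h, F (W + h) ≤ F W + inner ℝ v h + C * ‖h‖ ^ 2) :
    η / 2 * ‖v‖ ^ 2 ≤ F W - F (W - η • g) + η / 2 * ‖g - v‖ ^ 2 := by
  have h := hF (-(η • g))
  rw [← sub_eq_add_neg, inner_neg_right, inner_smul_right, norm_neg, norm_smul, mul_pow,
    Real.norm_eq_abs, sq_abs] at h
  have h2 : C * (η ^ 2 * ‖g‖ ^ 2) ≤ 1 / 2 * (η * ‖g‖ ^ 2) := by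
    have : C * (η ^ 2 * ‖g‖ ^ 2) = C * η * (η * ‖g‖ ^ 2) := by ring
    rw [this]; gcongr
  rw [norm_sub_sq_real, real_inner_comm v g]
  linarith

/-- If `Y` and `s` are independent, and the mean of `φ (y, s)` is at most `c` for every fixed
`y ∈ A`, then so is the mean of `φ (Y, s)` on the event `Y ∈ A`, up to the probability of this
event. -/
theorem setIntegral_le_of_indepFun {Ω H S : Type*} [MeasurableSpace Ω] [MeasurableSpace H]
    [MeasurableSpace S] {P : Measure Ω} [IsProbabilityMeasure P] {Y : Ω → H} {s : Ω → S}
    (hY : Measurable Y) (hs : Measurable s) (hind : IndepFun Y s P) {φ : H → S → ℝ}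
    (hφ : Measurable (Function.uncurry φ)) {d : ℝ} (hd : ∀ y x, |φ y x| ≤ d) {A : Set H}
    (hA : MeasurableSet A) {c : ℝ} (hc : ∀ y ∈ A, ∫ x, φ y x ∂(P.map s) ≤ c) :
    ∫ ω in Y ⁻¹' A, φ (Y ω) (s ω) ∂P ≤ c * P.real (Y ⁻¹' A) := by
  have : IsProbabilityMeasure (P.map Y) := Measure.isProbabilityMeasure_map hY.aemeasurable
  have : IsProbabilityMeasure (P.map s) := Measure.isProbabilityMeasure_map hs.aemeasurable
  have hprod := (indepFun_iff_map_prod_eq_prod_map_map hY.aemeasurable hs.aemeasurable).1 hind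
  have hint : Integrable (Function.uncurry φ) ((P.map Y).prod (P.map s)) :=
    Integrable.of_bound hφ.aestronglyMeasurable d (ae_of_all _ fun z => hd z.1 z.2)
  have h1 : ∫ ω in Y ⁻¹' A, φ (Y ω) (s ω) ∂P =
      ∫ y in A, ∫ x, φ y x ∂(P.map s) ∂(P.map Y) := by
    have e : Y ⁻¹' A = (fun ω => (Y ω, s ω)) ⁻¹' (A ×ˢ Set.univ) := by ext; simp
    rw [e]
    have := setIntegral_map (μ := P) (g := fun ω => (Y ω, s ω)) (f := Function.uncurry φ)
      (hA.prod MeasurableSet.univ) hφ.aestronglyMeasurable (hY.prodMk hs).aemeasurable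
    rw [hprod, setIntegral_prod _ hint.integrableOn] at this
    simpa using this.symm
  rw [h1]
  calc ∫ y in A, ∫ x, φ y x ∂(P.map s) ∂(P.map Y) ≤ ∫ y in A, c ∂(P.map Y) :=
        setIntegral_mono_on hint.integral_prod_left.integrableOn (integrable_const c).integrableOn
          hA hc
    _ = c * P.real (Y ⁻¹' A) := by
        rw [setIntegral_const, smul_eq_mul, mul_comm, map_measureReal_apply hY hA]

/-- The initial state and the data of the first `t` steps. -/
def history {Ω E : Type*} {S : ℕ → Type*} (W : ℕ → Ω → E) (sample : ∀ t, Ω → S t) (t : ℕ) (ω : Ω) :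
    E × (∀ i : Finset.range t, S i) :=
  (W 0 ω, fun i => sample i ω)

section History

variable {Ω E : Type*} {S : ℕ → Type*} [MeasurableSpace E] [∀ t, MeasurableSpace (S t)]
  {W : ℕ → Ω → E} {sample : ∀ t, Ω → S t}

/-- The state at a time `s ≤ t` is a measurable function of the history up to time `t`. -/
theorem exists_eq_comp_history {step : ∀ t, E → S t → E}
    (hstep : ∀ t, Measurable (Function.uncurry (step t)))
    (hW : ∀ t ω, W (t + 1) ω = step t (W t ω) (sample t ω)) {s t : ℕ} (hst : s ≤ t) :
    ∃ w : E × (∀ i : Finset.range t, S i) → E, Measurable w ∧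
      ∀ ω, W s ω = w (history W sample t ω) := by
  induction s with
  | zero => exact ⟨Prod.fst, measurable_fst, fun _ => rfl⟩
  | succ s ih =>
    obtain ⟨w, hw, h⟩ := ih (by omega)
    have hs : Measurable fun y : E × (∀ i : Finset.range t, S i) =>
        y.2 ⟨s, Finset.mem_range.2 hst⟩ :=
      (measurable_pi_apply (⟨s, Finset.mem_range.2 hst⟩ : Finset.range t)).comp measurable_snd
    refine ⟨fun y => step s (w y) (y.2 ⟨s, Finset.mem_range.2 hst⟩),
      (hstep s).comp (hw.prodMk hs), fun ω => ?_⟩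
    rw [hW, h]
    rfl

variable [MeasurableSpace Ω] {P : Measure Ω}

theorem measurable_history (hW : Measurable (W 0)) (hs : ∀ t, Measurable (sample t)) (t : ℕ) :
    Measurable (history W sample t) :=
  hW.prodMk (measurable_pi_lambda _ fun i => hs i)

theorem indepFun_history [IsProbabilityMeasure P] (hW : Measurable (W 0))
    (hs : ∀ t, Measurable (sample t)) (hind : iIndepFun sample P)
    (hind0 : IndepFun (W 0) (fun ω t => sample t ω) P) (t : ℕ) :
    IndepFun (history W sample t) (sample t) P := by
  set Y : Ω → ∀ i : Finset.range t, S i := fun ω i => sample i ω with hY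
  have mY : Measurable Y := measurable_pi_lambda _ fun i => hs i
  have h1 : IndepFun Y (sample t) P :=
    (hind.indepFun_finset (Finset.range t) {t} (by simp) hs).comp (φ := id)
      (ψ := fun z : (∀ i : ({t} : Finset ℕ), S i) => z ⟨t, Finset.mem_singleton_self t⟩)
      measurable_id (measurable_pi_apply _)
  have h2 : IndepFun (W 0) (fun ω => (Y ω, sample t ω)) P :=
    hind0.comp (φ := id)
      (ψ := fun z : ∀ t, S t => ((fun i : Finset.range t => z i), z t)) measurable_id
      (by fun_prop)
  have h3 : IndepFun (W 0) Y P :=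
    h2.comp (φ := id) (ψ := Prod.fst) measurable_id measurable_fst
  have : IsProbabilityMeasure (P.map (W 0)) := Measure.isProbabilityMeasure_map hW.aemeasurable
  have : IsProbabilityMeasure (P.map Y) := Measure.isProbabilityMeasure_map mY.aemeasurable
  have : IsProbabilityMeasure (P.map (sample t)) :=
    Measure.isProbabilityMeasure_map (hs t).aemeasurable
  rw [indepFun_iff_map_prod_eq_prod_map_map (by fun_prop) (by fun_prop)] at h1 h2 h3
  change IndepFun (fun ω => (W 0 ω, Y ω)) (sample t) P
  rw [indepFun_iff_map_prod_eq_prod_map_map (by fun_prop) (by fun_prop), h3]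
  have h4 : P.map (fun ω => ((W 0 ω, Y ω), sample t ω)) =
      (P.map (fun ω => (W 0 ω, (Y ω, sample t ω)))).map MeasurableEquiv.prodAssoc.symm := by
    rw [Measure.map_map (MeasurableEquiv.measurable _) (by fun_prop)]
    rfl
  rw [h4, h2, h1]
  exact ((measurePreserving_prodAssoc (P.map (W 0)) (P.map Y) (P.map (sample t))).symm _).map_eq

/-- A bound on the mean of `φ (w, sample t)` that holds for all fixed states `w ∈ D` holds for the
state at time `t`, on the event that no state up to time `t` has left `D`. -/
theorem setIntegral_le_of_stays [IsProbabilityMeasure P] (hW0 : Measurable (W 0))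
    (hs : ∀ t, Measurable (sample t)) (hind : iIndepFun sample P)
    (hind0 : IndepFun (W 0) (fun ω t => sample t ω) P)
    {step : ∀ t, E → S t → E} (hstep : ∀ t, Measurable (Function.uncurry (step t)))
    (hW : ∀ t ω, W (t + 1) ω = step t (W t ω) (sample t ω))
    {t : ℕ} {φ : E → S t → ℝ} (hφ : Measurable (Function.uncurry φ)) {d : ℝ}
    (hd : ∀ w x, |φ w x| ≤ d) {D : Set E} (hD : MeasurableSet D) {c : ℝ}
    (hc : ∀ w ∈ D, ∫ x, φ w x ∂(P.map (sample t)) ≤ c) :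
    ∫ ω in {ω | ∀ s ≤ t, W s ω ∈ D}, φ (W t ω) (sample t ω) ∂P ≤
      c * P.real {ω | ∀ s ≤ t, W s ω ∈ D} := by
  choose w hw hWw using fun s : {s // s ≤ t} => exists_eq_comp_history hstep hW s.2
  set A := {y | ∀ s, w s y ∈ D} with hA
  have mA : MeasurableSet A := by
    simp only [hA, Set.ofPred_forall]
    exact MeasurableSet.iInter fun s => hw s hD
  have e : {ω | ∀ s ≤ t, W s ω ∈ D} = history W sample t ⁻¹' A := by
    ext ω
    simp only [hA, Set.mem_ofPred_eq, Set.mem_preimage, ← hWw, Subtype.forall]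
  rw [e]
  have := setIntegral_le_of_indepFun (measurable_history hW0 hs t) (hs t)
    (indepFun_history hW0 hs hind hind0 t) (φ := fun y x => φ (w ⟨t, le_rfl⟩ y) x)
    (hφ.comp (((hw _).comp measurable_fst).prodMk measurable_snd)) (fun y x => hd _ x) mA
    (fun y hy => hc _ (hy _))
  simpa only [← hWw] using this

end History

/-- If a bounded potential `u` decreases in expectation by at least `θ` in every step before the
hitting time of `{r ≤ ε}`, then the mean of this time is at most the range of the potential divided
by `θ`. -/
theorem lintegral_hittingTime_le {Ω : Type*} [MeasurableSpace Ω] {P : Measure Ω}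
    [IsProbabilityMeasure P] {u r : ℕ → Ω → ℝ} (hu : ∀ t, Measurable (u t))
    (hr : ∀ t, Measurable (r t)) {c : ℝ} (hu0 : ∀ t ω, 0 ≤ u t ω) (huc : ∀ t ω, u t ω ≤ c)
    {ε θ : ℝ} (hθ : 0 < θ)
    (hdec : ∀ t, θ * P.real {ω | ∀ s ≤ t, ε < r s ω} ≤
      ∫ ω in {ω | ∀ s ≤ t, ε < r s ω}, (u t ω - u (t + 1) ω) ∂P) :
    ∫⁻ ω, ⨅ (t : ℕ) (_ : r t ω ≤ ε), (t : ℝ≥0∞) ∂P ≤ ENNReal.ofReal (c / θ) := by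
  set A : ℕ → Set Ω := fun t => {ω | ∀ s ≤ t, ε < r s ω} with hA
  have mA : ∀ t, MeasurableSet (A t) := fun t => by
    simp only [hA, Set.ofPred_forall]
    exact MeasurableSet.iInter fun s => MeasurableSet.iInter fun _ =>
      measurableSet_lt measurable_const (hr s)
  have hc : 0 ≤ c := by
    obtain ⟨ω⟩ := P.nonempty_of_neZero
    exact (hu0 0 ω).trans (huc 0 ω)
  have huint : ∀ t, Integrable (u t) P := fun t =>
    Integrable.of_bound (hu t).aestronglyMeasurable c
      (ae_of_all _ fun ω => by rw [Real.norm_of_nonneg (hu0 t ω)]; exact huc t ω)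
  -- The sum telescopes, because the events `A t` decrease and the potential is nonnegative.
  have htel : ∀ (T : ℕ) ω, ∑ t ∈ Finset.range T, (A t).indicator (fun ω => u t ω - u (t + 1) ω) ω ≤
      u 0 ω - (A T).indicator (u T) ω := by
    intro T ω
    induction T with
    | zero =>
      by_cases h : ω ∈ A 0 <;> simp [h, hu0 0 ω]
    | succ T ih =>
      rw [Finset.sum_range_succ]
      by_cases h1 : ω ∈ A (T + 1)
      · have h0 : ω ∈ A T := fun s hs => h1 s (by omega)
        simp only [h1, h0, Set.indicator_of_mem] at ih ⊢
        linarith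
      · by_cases h0 : ω ∈ A T <;>
          simp only [h1, h0, Set.indicator_of_mem, Set.indicator_of_notMem,
            not_false_eq_true] at ih ⊢
        · linarith [hu0 (T + 1) ω]
        · linarith
  have hsum : ∀ T, ∑ t ∈ Finset.range T, P.real (A t) ≤ c / θ := by
    intro T
    rw [le_div_iff₀ hθ, mul_comm, Finset.mul_sum]
    have hi : ∀ t, Integrable ((A t).indicator fun ω => u t ω - u (t + 1) ω) P := fun t =>
      ((huint t).sub (huint (t + 1))).indicator (mA t)
    calc ∑ t ∈ Finset.range T, θ * P.real (A t)
        ≤ ∑ t ∈ Finset.range T, ∫ ω, (A t).indicator (fun ω => u t ω - u (t + 1) ω) ω ∂P :=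
          Finset.sum_le_sum fun t _ => by
            rw [integral_indicator (mA t)]
            exact hdec t
      _ = ∫ ω, ∑ t ∈ Finset.range T, (A t).indicator (fun ω => u t ω - u (t + 1) ω) ω ∂P :=
          (integral_finsetSum _ fun t _ => hi t).symm
      _ ≤ ∫ _, c ∂P := by
          refine integral_mono (integrable_finsetSum _ fun t _ => hi t) (integrable_const c)
            fun ω => (htel T ω).trans ?_
          have : 0 ≤ (A T).indicator (u T) ω := Set.indicator_nonneg (fun ω _ => hu0 T ω) ω
          linarith [huc 0 ω]
      _ = c := by simp
  have hpt : ∀ ω, ⨅ (t : ℕ) (_ : r t ω ≤ ε), (t : ℝ≥0∞) ≤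
      ∑' t, (A t).indicator (fun _ => (1 : ℝ≥0∞)) ω := by
    intro ω
    by_cases h : ∃ t, r t ω ≤ ε
    · classical
      refine (iInf₂_le (Nat.find h) (Nat.find_spec h)).trans ?_
      refine le_trans ?_ (ENNReal.sum_le_tsum (Finset.range (Nat.find h)))
      rw [Finset.sum_congr rfl fun t ht => Set.indicator_of_mem (s := A t) (f := fun _ => (1 : ℝ≥0∞))
        (fun s hs => not_le.1 (Nat.find_min h (hs.trans_lt (Finset.mem_range.1 ht))))]
      simp
    · push Not at h
      rw [tsum_congr fun t => Set.indicator_of_mem (s := A t) (f := fun _ => (1 : ℝ≥0∞))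
        (fun s _ => h s)]
      simp
  calc ∫⁻ ω, ⨅ (t : ℕ) (_ : r t ω ≤ ε), (t : ℝ≥0∞) ∂P
      ≤ ∫⁻ ω, ∑' t, (A t).indicator (fun _ => (1 : ℝ≥0∞)) ω ∂P := lintegral_mono hpt
    _ = ∑' t, P (A t) := by
        rw [lintegral_tsum fun t => (measurable_const.indicator (mA t)).aemeasurable]
        exact tsum_congr fun t => lintegral_indicator_one (mA t)
    _ ≤ ENNReal.ofReal (c / θ) := by
        refine ENNReal.tsum_le_of_sum_range_le fun T => ?_
        have : ∀ t, P (A t) = ENNReal.ofReal (P.real (A t)) := fun t => by simp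
        rw [Finset.sum_congr rfl fun t _ => this t,
          ← ENNReal.ofReal_sum_of_nonneg fun _ _ => measureReal_nonneg]
        exact ENNReal.ofReal_le_ofReal (hsum T)

/-- If a quantity `x t` is paid out of the decrease of a potential with range `c`, up to an error
`δ` in each step, then some `x t` with `t < T` is at most `c / T + δ`. -/
theorem exists_le_of_sum_decrease {T : ℕ} (hT : 0 < T) {u x : ℕ → ℝ} {c δ : ℝ}
    (hu0 : 0 ≤ u T) (huc : u 0 ≤ c) (h : ∀ t < T, x t ≤ u t - u (t + 1) + δ) :
    ∃ t < T, x t ≤ c / T + δ := by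
  by_contra! hcon
  have h1 : ∑ _t ∈ Finset.range T, (c / T + δ) < ∑ t ∈ Finset.range T, x t :=
    Finset.sum_lt_sum_of_nonempty (by simpa using hT.ne') fun t ht =>
      hcon t (Finset.mem_range.1 ht)
  have h2 : ∑ t ∈ Finset.range T, x t ≤ ∑ t ∈ Finset.range T, (u t - u (t + 1) + δ) :=
    Finset.sum_le_sum fun t ht => h t (Finset.mem_range.1 ht)
  rw [Finset.sum_add_distrib, Finset.sum_range_sub'] at h2
  simp only [Finset.sum_const, Finset.card_range, nsmul_eq_mul] at h1 h2
  have hT' : (0 : ℝ) < T := by exact_mod_cast hT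
  have : (T : ℝ) * (c / T + δ) = c + T * δ := by field_simp
  linarith

/-! ### Breadth-first neighbourhoods are finite -/

namespace RootedGraph

variable {X A : Type*}

theorem ball_mono (g : RootedGraph X A) : Monotone g.ball :=
  monotone_nat_of_le_succ fun _ _ hv => Or.inl hv

/-- Among more than `N` vertices of the component, the last one in breadth-first order has at least
`N` predecessors. -/
theorem finite_bfsSet (N : ℕ) (g : RootedGraph X A) : (g.bfsSet N).Finite := by
  classical
  set T : Set ℕ := {v | (∃ k, v ∈ g.ball k) ∧ {u | g.Before u v}.encard < (N : ℕ∞)} with hT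
  have hsub : g.bfsSet N = insert g.root T := rfl
  rw [hsub]
  refine Set.Finite.insert _ ?_
  by_contra hinf
  obtain ⟨s, hsT, hcard⟩ := Set.Infinite.exists_subset_card_eq hinf (N + 1)
  -- `d` is the distance to the root, so that breadth-first order is lexicographic order of `(d v, v)`.
  set d : ℕ → ℕ := fun v => sInf {k | v ∈ g.ball k} with hd
  have hmem : ∀ v ∈ s, ∀ k, v ∈ g.ball k ↔ d v ≤ k := fun v hv k =>
    ⟨fun h => Nat.sInf_le h, fun h => g.ball_mono h (Nat.sInf_mem (hsT hv).1)⟩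
  obtain ⟨v, hv, hmax⟩ := s.exists_max_image (fun v => toLex (d v, v))
    (Finset.card_pos.1 (by omega))
  have hbefore : ∀ u ∈ s.erase v, g.Before u v := by
    intro u hu
    obtain ⟨huv, hus⟩ := Finset.mem_erase.1 hu
    have h := hmax u hus
    rw [Prod.Lex.toLex_le_toLex] at h
    rcases h with h | ⟨h, h'⟩
    · exact Or.inl ⟨d u, (hmem u hus _).2 le_rfl,
        fun hc => absurd ((hmem v hv _).1 hc) (not_le.2 h)⟩
    · refine Or.inr ⟨fun k => ?_, lt_of_le_of_ne h' huv⟩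
      have h : d u = d v := h
      rw [hmem u hus, hmem v hv, h]
  refine (encard_lt_iff _ N).1 (hsT hv).2 ⟨s.erase v, ?_, hbefore⟩
  rw [Finset.card_erase_of_mem hv, hcard]
  rfl

end RootedGraph

open RootedGraph

variable {X A : Type*} [MeasurableSpace X] [MeasurableSpace A] {p : ℕ}

/-! ### The loss as a smooth family -/

theorem measurableSet_isIn :
    MeasurableSet {z : RootedGraph X A × CompGraph | CompGraph.IsIn z.2 z.1} := by
  refine measurableSet_setOfPred.2 (measurable_from_prod_countable_left fun c => ?_)
  unfold CompGraph.IsIn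
  exact Measurable.forall fun e =>
    (measurable_const (a := e ∈ c)).imp (measurable_adj e.2.1 e.2.2)

namespace SamplingGNN

variable (M : SamplingGNN X A p)

open Classical in
/-- The loss at the root of a rooted graph with a computational graph, set to `0` on the null set
where the computational graph uses edges that are not there, so that its regularity holds
everywhere. -/
noncomputable def pairLoss (W : Coeffs p) (z : RootedGraph X A × CompGraph) : ℝ :=
  if CompGraph.IsIn z.2 z.1 then M.nodeLoss W z.1 z.2 else 0

open Classical in
/-- The gradient of `pairLoss` in the coefficients. -/
noncomputable def pairGrad (W : Coeffs p) (z : RootedGraph X A × CompGraph) : Coeffs p :=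
  if CompGraph.IsIn z.2 z.1 then M.nodeGrad W z.1 z.2 else 0

variable {M} {b : ℝ} {C : ℝ≥0}

theorem measurable_pairLoss (hmeas : ∀ W c, Measurable fun g => M.nodeLoss W g c) (W : Coeffs p) :
    Measurable (M.pairLoss W) :=
  Measurable.ite measurableSet_isIn (measurable_from_prod_countable_left fun c => hmeas W c)
    measurable_const

theorem RegularLoss.expansion (hreg : M.RegularLoss b C) (W h : Coeffs p)
    (z : RootedGraph X A × CompGraph) :
    |M.pairLoss (W + h) z - M.pairLoss W z - inner ℝ (M.pairGrad W z) h| ≤ C * ‖h‖ ^ 2 := by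
  by_cases hz : CompGraph.IsIn z.2 z.1
  · simp only [pairLoss, pairGrad, hz, if_true]
    exact abs_sub_sub_inner_gradient_le (hreg.differentiable _ _ hz) (hreg.lipschitz_grad _ _ hz)
      W h
  · simp only [pairLoss, pairGrad, hz, if_false]
    simp only [sub_self, inner_zero_left, abs_zero]
    positivity

/-- The gradient is measurable in the graph as a limit of difference quotients. -/
theorem RegularLoss.measurable_pairGrad (hreg : M.RegularLoss b C)
    (hmeas : ∀ W c, Measurable fun g => M.nodeLoss W g c) (W : Coeffs p) :
    Measurable (M.pairGrad W) := by
  suffices h : ∀ k, Measurable fun z => M.pairGrad W z k by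
    have : M.pairGrad W = fun z => WithLp.toLp 2 fun k => M.pairGrad W z k := rfl
    rw [this]
    exact (WithLp.measurable_toLp 2 _).comp (measurable_pi_lambda _ h)
  intro k
  set e : ℕ → Coeffs p := fun n => EuclideanSpace.single k ((n : ℝ) + 1)⁻¹ with he
  refine measurable_of_tendsto_metrizable
    (f := fun (n : ℕ) z => ((n : ℝ) + 1) * (M.pairLoss (W + e n) z - M.pairLoss W z))
    (fun n => measurable_const.mul
      ((measurable_pairLoss hmeas _).sub (measurable_pairLoss hmeas _))) ?_
  refine tendsto_pi_nhds.2 fun z => ?_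
  rw [tendsto_iff_norm_sub_tendsto_zero]
  have h0 : Tendsto (fun n : ℕ => (C : ℝ) * (1 / ((n : ℝ) + 1))) atTop (𝓝 0) := by
    simpa using tendsto_one_div_add_atTop_nhds_zero_nat.const_mul (C : ℝ)
  refine squeeze_zero (fun _ => norm_nonneg _) (fun n => ?_) h0
  have hn : (0 : ℝ) < (n : ℝ) + 1 := by positivity
  have h1 := hreg.expansion W (e n) z
  have h2 : inner ℝ (M.pairGrad W z) (e n) = ((n : ℝ) + 1)⁻¹ * M.pairGrad W z k := by
    simp [he, EuclideanSpace.inner_single_right]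
  have h3 : ‖e n‖ = ((n : ℝ) + 1)⁻¹ := by
    rw [he, PiLp.norm_single, Real.norm_of_nonneg (by positivity)]
  rw [h2, h3] at h1
  have h4 : ((n : ℝ) + 1) * (M.pairLoss (W + e n) z - M.pairLoss W z) - M.pairGrad W z k =
      ((n : ℝ) + 1) * (M.pairLoss (W + e n) z - M.pairLoss W z -
        ((n : ℝ) + 1)⁻¹ * M.pairGrad W z k) := by
    field_simp
  rw [h4, norm_mul, Real.norm_of_nonneg hn.le, Real.norm_eq_abs]
  calc ((n : ℝ) + 1) * _ ≤ ((n : ℝ) + 1) * (C * ((n : ℝ) + 1)⁻¹ ^ 2) := by gcongr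
    _ = C * (1 / ((n : ℝ) + 1)) := by field_simp

theorem RegularLoss.smoothFamily (hreg : M.RegularLoss b C) (hb : 0 ≤ b)
    (hmeas : ∀ W c, Measurable fun g => M.nodeLoss W g c) :
    SmoothFamily M.pairLoss M.pairGrad b C where
  measurable_loss := measurable_pairLoss hmeas
  measurable_grad := hreg.measurable_pairGrad hmeas
  abs_loss_le W z := by
    unfold pairLoss
    split_ifs with hz
    · exact hreg.bounded W _ _ hz
    · simpa using hb
  norm_grad_le W z := by
    unfold pairGrad
    split_ifs with hz
    · rw [nodeGrad, gradient, LinearIsometryEquiv.norm_map]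
      exact norm_fderiv_le_of_lipschitz ℝ (hreg.lipschitz _ _ hz)
    · simp
  lipschitz_loss W W' z := by
    unfold pairLoss
    split_ifs with hz
    · exact (hreg.lipschitz _ _ hz).norm_sub_le W W'
    · simp only [sub_self, abs_zero]; positivity
  lipschitz_grad W W' z := by
    unfold pairGrad
    split_ifs with hz
    · exact (hreg.lipschitz_grad _ _ hz).norm_sub_le W W'
    · simp only [sub_self, norm_zero]; positivity
  expansion := hreg.expansion

end SamplingGNN

/-! ### The laws of a computational graph in a finite graph and in the limit graph -/

variable (M : SamplingGNN X A p)

/-- The law of the limit graph together with the computational graph of its root. -/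
noncomputable def limitLaw (μ : Measure (RootedGraph X A)) : Measure (RootedGraph X A × CompGraph) :=
  μ ⊗ₘ M.sampler

/-- A node with its computational graph, seen as a rooted graph with a computational graph. -/
noncomputable def drawPair (g : RootedGraph X A) (d : ℕ × CompGraph) : RootedGraph X A × CompGraph :=
  (g.rerootAt d.1, d.2)

/-- The law of the graph `g`, rooted at a uniformly random node, together with the computational
graph of this node. -/
noncomputable def drawLaw (g : RootedGraph X A) : Measure (RootedGraph X A × CompGraph) :=
  (nodeDraw M g).map (drawPair g)

theorem measurable_drawPair :
    Measurable fun x : RootedGraph X A × (ℕ × CompGraph) => drawPair x.1 x.2 :=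
  measurable_from_prod_countable_left fun d =>
    (measurable_rerootAt d.1).prodMk (measurable_const (a := d.2))

theorem nodeDraw_univ (g : RootedGraph X A) :
    nodeDraw M g Set.univ = uniformOn g.verts Set.univ := by
  rw [nodeDraw, Kernel.compProd_apply MeasurableSet.univ]
  simp [uniformNode]

theorem isProbabilityMeasure_nodeDraw {g : RootedGraph X A} (hg : g.verts.Finite) :
    IsProbabilityMeasure (nodeDraw M g) :=
  ⟨by rw [nodeDraw_univ]; exact uniformOn_of_univ hg ⟨_, g.root_mem⟩⟩

instance (g : RootedGraph X A) : IsZeroOrProbabilityMeasure (nodeDraw M g) :=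
  ⟨by rw [nodeDraw_univ]; exact IsZeroOrProbabilityMeasure.measure_univ (μ := uniformOn g.verts)⟩

theorem measurable_drawPair_left (g : RootedGraph X A) : Measurable (drawPair g) :=
  measurable_of_countable _

instance (g : RootedGraph X A) : IsZeroOrProbabilityMeasure (drawLaw M g) := by
  unfold drawLaw; infer_instance

instance (μ : Measure (RootedGraph X A)) [IsProbabilityMeasure μ] :
    IsProbabilityMeasure (limitLaw M μ) := by
  unfold limitLaw; infer_instance

variable {M} {b : ℝ} {C : ℝ≥0}

theorem ae_nodeDraw_isIn (g : RootedGraph X A) :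
    ∀ᵐ d ∂(nodeDraw M g), CompGraph.IsIn (drawPair g d).2 (drawPair g d).1 := by
  refine Kernel.ae_compProd_of_ae_ae (Set.to_countable _).measurableSet ?_
  exact ae_of_all _ fun v => M.sampler_isIn (g.rerootAt v)

theorem integral_pairLoss_sampler (W : Coeffs p) (g : RootedGraph X A) :
    ∫ c, M.pairLoss W (g, c) ∂(M.sampler g) = M.expectedLoss W g := by
  refine integral_congr_ae ((M.sampler_isIn g).mono fun c hc => ?_)
  simp [SamplingGNN.pairLoss, hc]

theorem integral_pairLoss_limitLaw (S : SmoothFamily M.pairLoss M.pairGrad b C)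
    (μ : Measure (RootedGraph X A)) [IsProbabilityMeasure μ] (W : Coeffs p) :
    ∫ z, M.pairLoss W z ∂(limitLaw M μ) = ∫ g, M.expectedLoss W g ∂μ := by
  rw [limitLaw, Measure.integral_compProd (S.integrable_loss (limitLaw M μ) W)]
  simp only [integral_pairLoss_sampler]

theorem integral_pairGrad_limitLaw (S : SmoothFamily M.pairLoss M.pairGrad b C)
    (μ : Measure (RootedGraph X A)) [IsProbabilityMeasure μ] (W : Coeffs p) :
    ∫ z, M.pairGrad W z ∂(limitLaw M μ) = M.limitGrad μ W := by
  rw [limitLaw, Measure.integral_compProd (S.integrable_grad (limitLaw M μ) W),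
    SamplingGNN.limitGrad]
  refine integral_congr_ae (ae_of_all _ fun g => ?_)
  refine integral_congr_ae ((M.sampler_isIn g).mono fun c hc => ?_)
  simp [SamplingGNN.pairGrad, hc]

theorem integral_pairLoss_drawLaw (S : SmoothFamily M.pairLoss M.pairGrad b C)
    (g : RootedGraph X A) (W : Coeffs p) :
    ∫ z, M.pairLoss W z ∂(drawLaw M g) = nodeAvg (M.expectedLoss W) g := by
  have hint : Integrable (fun d => M.pairLoss W (drawPair g d)) (nodeDraw M g) :=
    Integrable.of_bound (measurable_of_countable _).aestronglyMeasurable b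
      (ae_of_all _ fun d => S.abs_loss_le W _)
  rw [drawLaw, integral_map (measurable_drawPair_left g).aemeasurable
    (S.measurable_loss W).aestronglyMeasurable]
  rw [nodeDraw] at hint ⊢
  rw [ProbabilityTheory.integral_compProd hint]
  exact integral_congr_ae (ae_of_all _ fun v => integral_pairLoss_sampler W (g.rerootAt v))

/-! ### The error of the minibatch gradient -/

variable (M) in
/-- The minibatch gradient with `pairGrad` in place of `nodeGrad`; the two agree almost surely. -/
noncomputable def pairBatchGrad {B : ℕ} (W : Coeffs p) (s : StepSample X A B) : Coeffs p :=
  (B : ℝ)⁻¹ • ∑ i, M.pairGrad W (drawPair s.1 (s.2 i))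

theorem measurable_drawPair_apply {B : ℕ} (i : Fin B) :
    Measurable fun s : StepSample X A B => drawPair s.1 (s.2 i) :=
  measurable_drawPair.comp
    (measurable_fst.prodMk ((measurable_pi_apply i).comp measurable_snd))

theorem measurable_pairBatchGrad (S : SmoothFamily M.pairLoss M.pairGrad b C) {B : ℕ} :
    Measurable (Function.uncurry (pairBatchGrad M (B := B))) := by
  have h : Measurable (Function.uncurry M.pairGrad) :=
    measurable_uncurry_of_continuous_of_measurable
      (fun z => (LipschitzWith.of_dist_le_mul (K := C) fun W W' => by
        rw [dist_eq_norm, dist_eq_norm]; exact S.lipschitz_grad W W' z).continuous)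
      S.measurable_grad
  have hi : ∀ i : Fin B, Measurable fun x : Coeffs p × StepSample X A B =>
      M.pairGrad x.1 (drawPair x.2.1 (x.2.2 i)) := fun i =>
    h.comp (measurable_fst.prodMk ((measurable_drawPair_apply i).comp measurable_snd))
  exact (Finset.measurable_fun_sum _ fun i _ => hi i).const_smul (B : ℝ)⁻¹

theorem norm_pairBatchGrad_le (S : SmoothFamily M.pairLoss M.pairGrad b C) {B : ℕ} (W : Coeffs p)
    (s : StepSample X A B) : ‖pairBatchGrad M W s‖ ≤ C := by
  rcases Nat.eq_zero_or_pos B with rfl | hB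
  · simp [pairBatchGrad]
  · have hB' : (0 : ℝ) < B := by exact_mod_cast hB
    rw [pairBatchGrad, norm_smul, norm_inv, Real.norm_of_nonneg hB'.le, inv_mul_le_iff₀ hB']
    refine (norm_sum_le_of_le _ fun i _ => S.norm_grad_le W _).trans ?_
    simp

theorem ae_batchGrad_eq (μ : Measure (RootedGraph X A)) [IsProbabilityMeasure μ] (N B : ℕ) :
    ∀ᵐ s ∂(stepLaw M μ N B), ∀ W, batchGrad M W s = pairBatchGrad M W s := by
  have h : ∀ᵐ s ∂(stepLaw M μ N B), ∀ i, CompGraph.IsIn (drawPair s.1 (s.2 i)).2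
      (drawPair s.1 (s.2 i)).1 := by
    refine Measure.ae_compProd_of_ae_ae ?_ (ae_of_all _ fun g => ?_)
    · simp only [Set.ofPred_forall]
      exact MeasurableSet.iInter fun i => measurable_drawPair_apply i measurableSet_isIn
    · exact Filter.eventually_all.2 fun i =>
        (Measure.tendsto_eval_ae_ae (μ := fun _ : Fin B => nodeDraw M g) (i := i)).eventually
          (ae_nodeDraw_isIn g)
  filter_upwards [h] with s hs W
  simp only [batchGrad, pairBatchGrad, SamplingGNN.pairGrad, if_pos (hs _)]
  rfl

theorem abs_norm_sub_sq_le {E : Type*} [NormedAddCommGroup E] {x y : E} {c : ℝ} (hx : ‖x‖ ≤ c)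
    (hy : ‖y‖ ≤ c) : |‖x - y‖ ^ 2| ≤ 4 * c ^ 2 := by
  rw [abs_of_nonneg (by positivity)]
  have h : ‖x - y‖ ≤ 2 * c := (norm_sub_le _ _).trans (by linarith)
  calc ‖x - y‖ ^ 2 ≤ (2 * c) ^ 2 := by gcongr
    _ = 4 * c ^ 2 := by ring

/-- The event that, for some coefficients in `D`, the mean loss over the nodes of a graph differs by
at least `δ` from the loss of the limit GNN. -/
def lossGap (M : SamplingGNN X A p) (μ : Measure (RootedGraph X A)) (D : Set (Coeffs p)) (δ : ℝ) :
    Set (RootedGraph X A) :=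
  {g | ∃ W ∈ D, δ ≤ |∫ z, M.pairLoss W z ∂(drawLaw M g) - ∫ z, M.pairLoss W z ∂(limitLaw M μ)|}

instance isProbabilityMeasure_map_bfs (μ : Measure (RootedGraph X A)) [IsProbabilityMeasure μ]
    (N : ℕ) : IsProbabilityMeasure (μ.map (bfs N)) :=
  Measure.isProbabilityMeasure_map (measurable_bfs N).aemeasurable

theorem ae_map_bfs_finite (μ : Measure (RootedGraph X A)) (N : ℕ) :
    ∀ᵐ g ∂(μ.map (bfs N)), g.verts.Finite := by
  have hm : MeasurableSet {g : RootedGraph X A | g.verts.Finite} :=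
    measurable_verts (Set.Countable.measurableSet Set.Countable.ofPred_finite)
  exact (ae_map_iff (measurable_bfs N).aemeasurable hm).2 (ae_of_all _ fun g => finite_bfsSet N g)

/-- If the mean losses converge in probability to the loss of the limit GNN, uniformly on a
neighbourhood of `D`, then the mean squared error of the minibatch gradient, as an estimate of the
limit gradient, is small uniformly on `D` for large subgraphs and minibatches. -/
theorem exists_integral_error_le (S : SmoothFamily M.pairLoss M.pairGrad b C)
    (μ : Measure (RootedGraph X A)) [IsProbabilityMeasure μ] {D D' : Set (Coeffs p)}
    (hDD' : ∀ W ∈ D, ∀ h, ‖h‖ ≤ 1 → W + h ∈ D')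
    (hgap : ∀ δ > 0, Tendsto (fun N => μ.map (bfs N) (lossGap M μ D' δ)) atTop (𝓝 0))
    {δ : ℝ} (hδ : 0 < δ) :
    ∃ N₀ B₀ : ℕ, 0 < N₀ ∧ 0 < B₀ ∧ ∀ N ≥ N₀, ∀ B ≥ B₀, ∀ W ∈ D,
      ∫ s, ‖pairBatchGrad M W s - M.limitGrad μ W‖ ^ 2 ∂(stepLaw M μ N B) ≤ δ := by
  have hC : (0 : ℝ) ≤ C := C.2
  -- The step `s` keeps the test points in `D'` and the curvature term below `δ / 16`.
  set s : ℝ := min (1 / (2 * C + 1)) (δ / (128 * C ^ 3 + 1)) with hs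
  have hs0 : 0 < s := lt_min (by positivity) (by positivity)
  have hs1 : s * (2 * C) ≤ 1 := by
    have : s ≤ 1 / (2 * C + 1) := min_le_left _ _
    rw [le_div_iff₀ (by positivity)] at this
    nlinarith
  have hs2 : 8 * C ^ 3 * s ≤ δ / 16 := by
    have : s ≤ δ / (128 * C ^ 3 + 1) := min_le_right _ _
    rw [le_div_iff₀ (by positivity)] at this
    nlinarith
  set δ' : ℝ := s * δ / 32 with hδ'
  have hδ'0 : 0 < δ' := by positivity
  have hη : 0 < ENNReal.ofReal (δ / (8 * (C ^ 2 + 1))) := ENNReal.ofReal_pos.2 (by positivity)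
  obtain ⟨N₀, hN₀⟩ := eventually_atTop.1 ((hgap δ' hδ'0).eventually_le_const hη)
  obtain ⟨B₀, hB₀⟩ := exists_nat_ge (8 * (C : ℝ) ^ 2 / δ)
  refine ⟨N₀ + 1, B₀ + 1, by omega, by omega, fun N hN B hB W hW => ?_⟩
  have hB0 : 0 < B := by omega
  have : Nonempty (Fin B) := ⟨⟨0, hB0⟩⟩
  have hB0' : (0 : ℝ) < B := by exact_mod_cast hB0
  have hBC : 2 * (C : ℝ) ^ 2 / B ≤ δ / 4 := by
    have h : (B₀ : ℝ) ≤ B := by exact_mod_cast (by omega : B₀ ≤ B)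
    have h' := hB₀.trans h
    rw [div_le_iff₀ hδ] at h'
    rw [div_le_iff₀ hB0']
    linarith
  have hΓ : ‖M.limitGrad μ W‖ ≤ C := by
    rw [← integral_pairGrad_limitLaw S]
    exact S.norm_integral_grad_le hC _ W
  set a := M.limitGrad μ W with ha
  -- The event `lossGap` is a union over all coefficients and need not be measurable.
  set G := toMeasurable (μ.map (bfs N)) (lossGap M μ D' δ') with hG
  have mG : MeasurableSet G := measurableSet_toMeasurable _ _
  have hφ : ∀ s : StepSample X A B, |‖pairBatchGrad M W s - a‖ ^ 2| ≤ 4 * (C : ℝ) ^ 2 := fun s =>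
    abs_norm_sub_sq_le (norm_pairBatchGrad_le S W s) hΓ
  have hmφ : Measurable fun s : StepSample X A B => ‖pairBatchGrad M W s - a‖ ^ 2 :=
    ((((measurable_pairBatchGrad S (B := B)).comp measurable_prodMk_left).sub_const a).norm.pow_const
      2)
  have hprob : ∀ᵐ g ∂(μ.map (bfs N)), IsProbabilityMeasure (nodeDraw M g) :=
    (ae_map_bfs_finite μ N).mono fun g hg => isProbabilityMeasure_nodeDraw M hg
  have hpt : ∀ᵐ g ∂(μ.map (bfs N)),
      ∫ x, ‖pairBatchGrad M W (g, x) - a‖ ^ 2 ∂(batchDraw M B g) ≤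
        δ / 2 + G.indicator (fun _ => 4 * (C : ℝ) ^ 2) g := by
    filter_upwards [hprob] with g hg
    change ∫ x, ‖pairBatchGrad M W (g, x) - a‖ ^ 2 ∂(Measure.pi fun _ : Fin B => nodeDraw M g) ≤ _
    by_cases hgG : g ∈ G
    · rw [Set.indicator_of_mem hgG]
      have := norm_integral_le_of_forall_le (F := ℝ) (c := 4 * (C : ℝ) ^ 2)
        (Measure.pi fun _ : Fin B => nodeDraw M g) (by positivity) fun x => hφ (g, x)
      have := (le_abs_self _).trans this
      linarith
    · rw [Set.indicator_of_notMem hgG, add_zero]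
      have hnot : g ∉ lossGap M μ D' δ' := fun h => hgG (subset_toMeasurable _ _ h)
      simp only [lossGap, Set.mem_ofPred_eq, not_exists, not_and, not_le] at hnot
      have hclose : ‖∫ z, M.pairGrad W z ∂(drawLaw M g) -
          ∫ z, M.pairGrad W z ∂(limitLaw M μ)‖ ^ 2 ≤ δ / 8 := by
        refine (S.norm_integral_grad_sub_sq_le hC (drawLaw M g) (limitLaw M μ) W hs0 (δ := δ')
          ?_ ?_).trans ?_
        · exact (hnot W (by simpa using hDD' W hW 0 (by simp))).le
        · refine (hnot _ (hDD' W hW _ ?_)).le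
          rw [norm_smul, norm_neg, Real.norm_of_nonneg hs0.le]
          refine le_trans ?_ hs1
          have h1 := S.norm_integral_grad_le hC (drawLaw M g) W
          have h2 := S.norm_integral_grad_le hC (limitLaw M μ) W
          gcongr
          exact (norm_sub_le _ _).trans (by linarith)
        · have : 2 * δ' / s = δ / 16 := by rw [hδ']; field_simp; norm_num
          linarith
      have hmean : ∫ d, M.pairGrad W (drawPair g d) ∂(nodeDraw M g) =
          ∫ z, M.pairGrad W z ∂(drawLaw M g) := by
        rw [drawLaw, integral_map (measurable_drawPair_left g).aemeasurable
          (S.measurable_grad W).aestronglyMeasurable]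
      have hvar := integral_norm_average_sub_sq_le (ι := Fin B) (nodeDraw M g)
        (x := fun d => M.pairGrad W (drawPair g d)) (measurable_of_countable _)
        (fun d => S.norm_grad_le W _) a
      rw [hmean, Fintype.card_fin, ha, ← integral_pairGrad_limitLaw S] at hvar
      rw [ha, ← integral_pairGrad_limitLaw S]
      refine hvar.trans ?_
      linarith
  have hint : Integrable (fun s : StepSample X A B => ‖pairBatchGrad M W s - a‖ ^ 2)
      ((μ.map (bfs N)) ⊗ₘ batchDraw M B) :=
    Integrable.of_bound hmφ.aestronglyMeasurable _ (ae_of_all _ hφ)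
  have hGmeas : (μ.map (bfs N)).real G ≤ δ / (8 * (C ^ 2 + 1)) := by
    rw [measureReal_def, hG, measure_toMeasurable]
    exact ENNReal.toReal_le_of_le_ofReal (by positivity) (hN₀ N (by omega))
  have hgint : Integrable (G.indicator fun _ => 4 * (C : ℝ) ^ 2) (μ.map (bfs N)) :=
    (integrable_const _).indicator mG
  rw [stepLaw, Measure.integral_compProd hint]
  calc ∫ g, ∫ x, ‖pairBatchGrad M W (g, x) - a‖ ^ 2 ∂(batchDraw M B g) ∂(μ.map (bfs N))
      ≤ ∫ g, (δ / 2 + G.indicator (fun _ => 4 * (C : ℝ) ^ 2) g) ∂(μ.map (bfs N)) :=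
        integral_mono_ae (Integrable.integral_compProd hint) ((integrable_const _).add hgint) hpt
    _ = δ / 2 + (μ.map (bfs N)).real G * (4 * (C : ℝ) ^ 2) := by
        rw [integral_add (integrable_const _) hgint, integral_indicator_const _ mG]
        simp
    _ ≤ δ / 2 + δ / (8 * (C ^ 2 + 1)) * (4 * (C : ℝ) ^ 2) := by gcongr
    _ ≤ δ := by
        have : δ / (8 * (C ^ 2 + 1)) * (4 * (C : ℝ) ^ 2) ≤ δ / 2 := by
          rw [div_mul_eq_mul_div, div_le_iff₀ (by positivity)]
          nlinarith
        linarith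

/-! ### Uniform convergence of the mean losses -/

theorem tendsto_lossGap_univ (S : SmoothFamily M.pairLoss M.pairGrad b C)
    {μ : Measure (RootedGraph X A)} [IsProbabilityMeasure μ]
    (hconv : LocallyConverges (fun N => μ.map (bfs N)) μ)
    (hunif : UniformlyAlmostLocal μ M.expectedLoss M.expectedLoss) {δ : ℝ} (hδ : 0 < δ) :
    Tendsto (fun N => μ.map (bfs N) (lossGap M μ Set.univ δ)) atTop (𝓝 0) := by
  have h := hunif _ (isProbabilityMeasure_map_bfs μ) (ae_map_bfs_finite μ) hconv δ hδ
  simpa only [lossGap, Set.mem_univ, true_and, integral_pairLoss_drawLaw S,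
    integral_pairLoss_limitLaw S] using h

/-- On a compact set of coefficients, pointwise convergence is uniform: the mean losses are
equi-Lipschitz, so that it suffices to control them on a finite net. -/
theorem tendsto_lossGap_of_isCompact (S : SmoothFamily M.pairLoss M.pairGrad b C)
    {μ : Measure (RootedGraph X A)} [IsProbabilityMeasure μ]
    (hconv : LocallyConverges (fun N => μ.map (bfs N)) μ)
    (hloc : ∀ W, AlmostLocal μ (M.expectedLoss W) (M.expectedLoss W)) {D : Set (Coeffs p)}
    (hD : IsCompact D) {δ : ℝ} (hδ : 0 < δ) :
    Tendsto (fun N => μ.map (bfs N) (lossGap M μ D δ)) atTop (𝓝 0) := by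
  have hC : (0 : ℝ) ≤ C := C.2
  have hr : 0 < δ / (4 * C + 1) := by positivity
  obtain ⟨T, -, hTfin, hcover⟩ := hD.finite_cover_balls hr
  have hsub : lossGap M μ D δ ⊆ ⋃ W ∈ T, lossGap M μ {W} (δ / 2) := by
    rintro g ⟨W, hW, hg⟩
    obtain ⟨W', hW', hdist⟩ := Set.mem_iUnion₂.1 (hcover hW)
    refine Set.mem_iUnion₂.2 ⟨W', hW', W', rfl, ?_⟩
    rw [Metric.mem_ball, dist_eq_norm, lt_div_iff₀ (by positivity)] at hdist
    have h1 := S.lipschitz_integral_loss hC (drawLaw M g) W W'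
    have h2 := S.lipschitz_integral_loss hC (limitLaw M μ) W W'
    have h3 : 4 * (C * ‖W - W'‖) ≤ δ := by nlinarith [norm_nonneg (W - W')]
    have h4 := abs_sub_abs_le_abs_sub
      (∫ z, M.pairLoss W z ∂(drawLaw M g) - ∫ z, M.pairLoss W z ∂(limitLaw M μ))
      (∫ z, M.pairLoss W' z ∂(drawLaw M g) - ∫ z, M.pairLoss W' z ∂(limitLaw M μ))
    rw [sub_sub_sub_comm] at h4
    have h5 := h4.trans (abs_sub _ _)
    linarith
  have hpoint : ∀ W, Tendsto (fun N => μ.map (bfs N) (lossGap M μ {W} (δ / 2))) atTop (𝓝 0) := by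
    intro W
    have h := hloc W _ (isProbabilityMeasure_map_bfs μ) (ae_map_bfs_finite μ) hconv (δ / 2)
      (by positivity)
    simpa only [lossGap, Set.mem_singleton_iff, exists_eq_left, exists_const,
      integral_pairLoss_drawLaw S, integral_pairLoss_limitLaw S] using h
  refine tendsto_of_tendsto_of_tendsto_of_le_of_le tendsto_const_nhds
    (h := fun N => ∑ W ∈ hTfin.toFinset, μ.map (bfs N) (lossGap M μ {W} (δ / 2))) ?_
    (fun _ => zero_le) fun N => ?_
  · simpa using tendsto_finsetSum hTfin.toFinset fun W _ => hpoint W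
  · refine (measure_mono hsub).trans ?_
    have := measure_biUnion_finset_le (μ := μ.map (bfs N)) hTfin.toFinset
      fun W => lossGap M μ {W} (δ / 2)
    simpa using this

/-! ### The training objective -/

variable (M) in
/-- The expected loss of the limit GNN, which is the objective of the training. -/
noncomputable def limitLoss (μ : Measure (RootedGraph X A)) (W : Coeffs p) : ℝ :=
  ∫ z, M.pairLoss W z ∂(limitLaw M μ)

variable (M) in
/-- The squared error of the minibatch gradient in step `t`. -/
noncomputable def sqError {Ω : Type*} {B : ℕ → ℕ} (μ : Measure (RootedGraph X A))
    (W : ℕ → Ω → Coeffs p) (sample : ∀ t, Ω → StepSample X A (B t)) (t : ℕ) (ω : Ω) : ℝ :=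
  ‖pairBatchGrad M (W t ω) (sample t ω) - M.limitGrad μ (W t ω)‖ ^ 2

section Objective

variable (S : SmoothFamily M.pairLoss M.pairGrad b C) (μ : Measure (RootedGraph X A))
  [IsProbabilityMeasure μ]

include S

theorem norm_limitGrad_le (W : Coeffs p) : ‖M.limitGrad μ W‖ ≤ C := by
  rw [← integral_pairGrad_limitLaw S]
  exact S.norm_integral_grad_le C.2 _ W

theorem measurable_limitLoss : Measurable (limitLoss M μ) :=
  (LipschitzWith.of_dist_le_mul (K := C) fun W W' => by
    rw [dist_eq_norm, dist_eq_norm]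
    exact S.lipschitz_integral_loss C.2 (limitLaw M μ) W W').continuous.measurable

theorem measurable_limitGrad : Measurable (M.limitGrad μ) :=
  (LipschitzWith.of_dist_le_mul (K := C) fun W W' => by
    rw [dist_eq_norm, dist_eq_norm, ← integral_pairGrad_limitLaw S,
      ← integral_pairGrad_limitLaw S]
    exact S.lipschitz_integral_grad C.2 (limitLaw M μ) W W').continuous.measurable

theorem limitLoss_add_le (W h : Coeffs p) :
    limitLoss M μ (W + h) ≤ limitLoss M μ W + inner ℝ (M.limitGrad μ W) h + C * ‖h‖ ^ 2 := by
  have := (abs_le.1 (S.expansion_integral C.2 (limitLaw M μ) W h)).2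
  rw [integral_pairGrad_limitLaw S] at this
  unfold limitLoss
  linarith

theorem abs_sqError_le {Ω : Type*} {B : ℕ → ℕ} {W : ℕ → Ω → Coeffs p}
    {sample : ∀ t, Ω → StepSample X A (B t)} (t : ℕ) (ω : Ω) :
    |sqError M μ W sample t ω| ≤ 4 * (C : ℝ) ^ 2 :=
  abs_norm_sub_sq_le (norm_pairBatchGrad_le S _ _) (norm_limitGrad_le S μ _)

end Objective

/-! ### Measurable versions of training runs -/

section Run

variable {Ω : Type*} [MeasurableSpace Ω]

variable (M) in
/-- A training run with measurable random variables, in which the gradients are those of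
`pairLoss`. -/
structure MeasurableRun (μ : Measure (RootedGraph X A)) (ν : Measure (Coeffs p)) (η : ℝ)
    (N B : ℕ → ℕ) (P : Measure Ω) (W : ℕ → Ω → Coeffs p)
    (sample : ∀ t, Ω → StepSample X A (B t)) : Prop where
  measurable_init : Measurable (W 0)
  measurable_sample : ∀ t, Measurable (sample t)
  map_init : P.map (W 0) = ν
  map_sample : ∀ t, P.map (sample t) = stepLaw M μ (N t) (B t)
  indep_samples : iIndepFun sample P
  indep_init : IndepFun (W 0) (fun ω t => sample t ω) P
  update : ∀ t ω, W (t + 1) ω = W t ω - η • pairBatchGrad M (W t ω) (sample t ω)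

/-- Every training run agrees almost surely with a measurable one. -/
theorem TrainingRun.exists_measurableRun {μ : Measure (RootedGraph X A)} [IsProbabilityMeasure μ]
    {ν : Measure (Coeffs p)} {η : ℝ} {N B : ℕ → ℕ} {P : Measure Ω}
    (run : TrainingRun M μ ν η N B P) :
    ∃ (W : ℕ → Ω → Coeffs p) (sample : ∀ t, Ω → StepSample X A (B t)),
      MeasurableRun M μ ν η N B P W sample ∧ ∀ᵐ ω ∂P, ∀ t, run.W t ω = W t ω := by
  have h0 := run.law_init.aemeasurable
  have hs := fun t => (run.law_sample t).aemeasurable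
  set sample : ∀ t, Ω → StepSample X A (B t) := fun t => (hs t).mk with hsample
  have hae : ∀ t, run.sample t =ᵐ[P] sample t := fun t => (hs t).ae_eq_mk
  set W : ℕ → Ω → Coeffs p := fun t ω =>
    Nat.rec (h0.mk _ ω) (fun t w => w - η • pairBatchGrad M w (sample t ω)) t with hW
  have hW0 : W 0 = h0.mk _ := rfl
  refine ⟨W, sample, ⟨hW0 ▸ h0.measurable_mk, fun t => (hs t).measurable_mk, ?_, fun t => ?_,
    run.indep_samples.congr hae, run.indep_init.congr h0.ae_eq_mk ?_, fun t ω => rfl⟩, ?_⟩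
  · rw [hW0, ← Measure.map_congr h0.ae_eq_mk, run.law_init.map_eq]
  · rw [← Measure.map_congr (hae t), (run.law_sample t).map_eq]
  · filter_upwards [ae_all_iff.2 hae] with ω hω
    exact funext hω
  · have hgrad : ∀ t, ∀ᵐ ω ∂P, ∀ w, batchGrad M w (run.sample t ω) =
        pairBatchGrad M w (run.sample t ω) := fun t =>
      ae_of_ae_map (hs t) (by
        rw [(run.law_sample t).map_eq]
        exact ae_batchGrad_eq μ (N t) (B t))
    filter_upwards [h0.ae_eq_mk, ae_all_iff.2 hae, ae_all_iff.2 hgrad] with ω h1 h2 h3 t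
    induction t with
    | zero => exact h1
    | succ t ih => rw [run.update, h3, ih, h2]

namespace MeasurableRun

variable {μ : Measure (RootedGraph X A)} {ν : Measure (Coeffs p)} {η : ℝ}
  {N B : ℕ → ℕ} {P : Measure Ω} {W : ℕ → Ω → Coeffs p} {sample : ∀ t, Ω → StepSample X A (B t)}

theorem measurable_step (S : SmoothFamily M.pairLoss M.pairGrad b C) (t : ℕ) :
    Measurable (Function.uncurry fun (w : Coeffs p) (s : StepSample X A (B t)) =>
      w - η • pairBatchGrad M w s) :=
  measurable_fst.sub ((measurable_pairBatchGrad S).const_smul η)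

theorem measurable_state (r : MeasurableRun M μ ν η N B P W sample)
    (S : SmoothFamily M.pairLoss M.pairGrad b C) (t : ℕ) : Measurable (W t) := by
  induction t with
  | zero => exact r.measurable_init
  | succ t ih =>
    have : W (t + 1) = fun ω => W t ω - η • pairBatchGrad M (W t ω) (sample t ω) :=
      funext (r.update t)
    rw [this]
    exact (measurable_step S t).comp (ih.prodMk (r.measurable_sample t))

theorem norm_state_le (r : MeasurableRun M μ ν η N B P W sample)
    (S : SmoothFamily M.pairLoss M.pairGrad b C) (hη : 0 ≤ η) (t : ℕ) (ω : Ω) :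
    ‖W t ω‖ ≤ ‖W 0 ω‖ + η * C * t := by
  induction t with
  | zero => simp
  | succ t ih =>
    rw [r.update]
    have h1 : ‖η • pairBatchGrad M (W t ω) (sample t ω)‖ ≤ η * C := by
      rw [norm_smul, Real.norm_of_nonneg hη]
      have := norm_pairBatchGrad_le S (W t ω) (sample t ω)
      gcongr
    have h2 := norm_sub_le (W t ω) (η • pairBatchGrad M (W t ω) (sample t ω))
    push_cast
    linarith

theorem measurableSet_stays (r : MeasurableRun M μ ν η N B P W sample)
    (S : SmoothFamily M.pairLoss M.pairGrad b C) {D : Set (Coeffs p)} (hD : MeasurableSet D)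
    (t : ℕ) : MeasurableSet {ω | ∀ s ≤ t, W s ω ∈ D} := by
  simp only [Set.ofPred_forall]
  exact MeasurableSet.iInter fun s => MeasurableSet.iInter fun _ => r.measurable_state S s hD

variable [IsProbabilityMeasure μ]

theorem measurable_sqError (r : MeasurableRun M μ ν η N B P W sample)
    (S : SmoothFamily M.pairLoss M.pairGrad b C) (t : ℕ) :
    Measurable (sqError M μ W sample t) :=
  (((measurable_pairBatchGrad S).comp
    ((r.measurable_state S t).prodMk (r.measurable_sample t))).sub
      ((measurable_limitGrad S μ).comp (r.measurable_state S t))).norm.pow_const 2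

theorem integrable_sqError [IsProbabilityMeasure P] (r : MeasurableRun M μ ν η N B P W sample)
    (S : SmoothFamily M.pairLoss M.pairGrad b C) (t : ℕ) :
    Integrable (sqError M μ W sample t) P :=
  Integrable.of_bound (r.measurable_sqError S t).aestronglyMeasurable _
    (ae_of_all _ (abs_sqError_le S μ t))

theorem integrable_limitLoss [IsProbabilityMeasure P] (r : MeasurableRun M μ ν η N B P W sample)
    (S : SmoothFamily M.pairLoss M.pairGrad b C) (hb : 0 ≤ b) (t : ℕ) :
    Integrable (fun ω => limitLoss M μ (W t ω)) P :=
  Integrable.of_bound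
    ((measurable_limitLoss S μ).comp (r.measurable_state S t)).aestronglyMeasurable b
    (ae_of_all _ fun _ => S.abs_integral_loss_le hb _ _)

theorem integrable_norm_limitGrad [IsProbabilityMeasure P]
    (r : MeasurableRun M μ ν η N B P W sample) (S : SmoothFamily M.pairLoss M.pairGrad b C)
    (t n : ℕ) : Integrable (fun ω => ‖M.limitGrad μ (W t ω)‖ ^ n) P :=
  Integrable.of_bound
    ((((measurable_limitGrad S μ).comp (r.measurable_state S t)).norm.pow_const
      n).aestronglyMeasurable) ((C : ℝ) ^ n)
    (ae_of_all _ fun ω => by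
      rw [Real.norm_of_nonneg (by positivity)]
      have := norm_limitGrad_le S μ (W t ω)
      gcongr)

/-- The expected decrease of the objective in one step, restricted to an event `E`. -/
theorem setIntegral_descent [IsProbabilityMeasure P] (r : MeasurableRun M μ ν η N B P W sample)
    (S : SmoothFamily M.pairLoss M.pairGrad b C) (hb : 0 ≤ b) (hη : 0 < η)
    (hCη : (C : ℝ) * η ≤ 1 / 2) (t : ℕ) (E : Set Ω) :
    η / 2 * ∫ ω in E, ‖M.limitGrad μ (W t ω)‖ ^ 2 ∂P ≤
      ∫ ω in E, (limitLoss M μ (W t ω) - limitLoss M μ (W (t + 1) ω)) ∂P +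
        η / 2 * ∫ ω in E, sqError M μ W sample t ω ∂P := by
  have h1 : Integrable (fun ω => limitLoss M μ (W t ω) - limitLoss M μ (W (t + 1) ω)) P :=
    (r.integrable_limitLoss S hb t).sub (r.integrable_limitLoss S hb (t + 1))
  have h2 := (r.integrable_sqError S t).const_mul (η / 2)
  rw [← integral_const_mul, ← integral_const_mul,
    ← integral_add h1.integrableOn h2.integrableOn]
  refine integral_mono ((r.integrable_norm_limitGrad S t 2).const_mul (η / 2)).integrableOn
    (h1.add h2).integrableOn fun ω => ?_
  have := descent_step (g := pairBatchGrad M (W t ω) (sample t ω)) hη hCη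
    (limitLoss_add_le S μ (W t ω))
  rw [← r.update] at this
  exact this

/-- If the mean squared error of the minibatch gradient is at most `δ` for all fixed coefficients in
`D`, then it is so along the run, as long as the run stays in `D`. -/
theorem setIntegral_sqError_le [IsProbabilityMeasure P]
    (r : MeasurableRun M μ ν η N B P W sample) (S : SmoothFamily M.pairLoss M.pairGrad b C)
    {D : Set (Coeffs p)} (hD : MeasurableSet D) {t : ℕ} {δ : ℝ}
    (h : ∀ w ∈ D, ∫ s, ‖pairBatchGrad M w s - M.limitGrad μ w‖ ^ 2
      ∂(stepLaw M μ (N t) (B t)) ≤ δ) :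
    ∫ ω in {ω | ∀ s ≤ t, W s ω ∈ D}, sqError M μ W sample t ω ∂P ≤
      δ * P.real {ω | ∀ s ≤ t, W s ω ∈ D} := by
  refine setIntegral_le_of_stays (t := t) (d := 4 * (C : ℝ) ^ 2)
    (φ := fun w s => ‖pairBatchGrad M w s - M.limitGrad μ w‖ ^ 2) r.measurable_init
    r.measurable_sample r.indep_samples r.indep_init (measurable_step S) r.update ?_
    (fun w s => abs_norm_sub_sq_le (norm_pairBatchGrad_le S _ _) (norm_limitGrad_le S μ _)) hD ?_
  · exact ((measurable_pairBatchGrad S).sub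
      ((measurable_limitGrad S μ).comp measurable_fst)).norm.pow_const 2
  · rw [r.map_sample]
    exact h

/-- If the initial coefficients have norm at most `R` up to probability `κ`, and the mean squared
error of the minibatch gradient is at most `δ` on the ball that the run cannot leave within `T`
steps from there, then the mean squared error along the run is at most `δ + 4 C² κ`. -/
theorem integral_sqError_le [IsProbabilityMeasure P]
    (r : MeasurableRun M μ ν η N B P W sample) (S : SmoothFamily M.pairLoss M.pairGrad b C)
    (hη : 0 ≤ η) {R κ δ : ℝ} (hδ : 0 ≤ δ) {T t : ℕ} (htT : t ≤ T)
    (hR : ν.real {w | R < ‖w‖} ≤ κ)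
    (h : ∀ w ∈ Metric.closedBall (0 : Coeffs p) (R + η * C * T),
      ∫ s, ‖pairBatchGrad M w s - M.limitGrad μ w‖ ^ 2 ∂(stepLaw M μ (N t) (B t)) ≤ δ) :
    ∫ ω, sqError M μ W sample t ω ∂P ≤ δ + 4 * (C : ℝ) ^ 2 * κ := by
  set D := Metric.closedBall (0 : Coeffs p) (R + η * C * T)
  have mD : MeasurableSet D := measurableSet_closedBall
  set E := {ω | ∀ s ≤ t, W s ω ∈ D} with hE
  have mE : MeasurableSet E := r.measurableSet_stays S mD t
  have hEc : P.real Eᶜ ≤ κ := by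
    refine le_trans ?_ hR
    rw [← r.map_init, map_measureReal_apply r.measurable_init
      (measurableSet_lt measurable_const measurable_norm)]
    refine measureReal_mono fun ω hω => ?_
    by_contra hcon
    refine hω fun s hs => ?_
    have hcon : ‖W 0 ω‖ ≤ R := not_lt.1 hcon
    have h1 := r.norm_state_le S hη s ω
    have h2 : η * C * s ≤ η * C * T := by
      have : (s : ℝ) ≤ T := by exact_mod_cast hs.trans htT
      have : 0 ≤ η * (C : ℝ) := mul_nonneg hη C.2
      gcongr
    rw [Metric.mem_closedBall, dist_zero_right]
    linarith
  rw [← integral_add_compl mE (r.integrable_sqError S t)]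
  refine add_le_add ((r.setIntegral_sqError_le S mD h).trans ?_) ?_
  · exact mul_le_of_le_one_right hδ measureReal_le_one
  · calc ∫ ω in Eᶜ, sqError M μ W sample t ω ∂P ≤ ∫ _ in Eᶜ, 4 * (C : ℝ) ^ 2 ∂P :=
          integral_mono (r.integrable_sqError S t).integrableOn (integrable_const _)
            fun ω => (le_abs_self _).trans (abs_sqError_le S μ t ω)
      _ = 4 * (C : ℝ) ^ 2 * P.real Eᶜ := by
          rw [setIntegral_const, smul_eq_mul, mul_comm]
      _ ≤ 4 * (C : ℝ) ^ 2 * κ := by gcongr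

/-- If the mean squared error of the minibatch gradient is at most `ε² / 2` in the first `T` steps,
then one of these steps starts at a point where the limit gradient has mean norm at most `ε`. -/
theorem exists_integral_norm_limitGrad_le [IsProbabilityMeasure P]
    (r : MeasurableRun M μ ν η N B P W sample) (S : SmoothFamily M.pairLoss M.pairGrad b C)
    (hb : 0 ≤ b) (hη : 0 < η) (hCη : (C : ℝ) * η ≤ 1 / 2) {ε : ℝ} (hε : 0 < ε) {T : ℕ}
    (hT0 : 0 < T) (hT : 8 * b / η ≤ T * ε ^ 2)
    (herr : ∀ t < T, ∫ ω, sqError M μ W sample t ω ∂P ≤ ε ^ 2 / 2) :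
    ∃ t < T, ∫ ω, ‖M.limitGrad μ (W t ω)‖ ∂P ≤ ε := by
  have hlow : ∀ t, |∫ ω, limitLoss M μ (W t ω) ∂P| ≤ b := fun t =>
    norm_integral_le_of_forall_le (F := ℝ) P hb fun ω => S.abs_integral_loss_le hb _ _
  obtain ⟨t, htT, ht⟩ := exists_le_of_sum_decrease (c := 2 * b) (δ := η / 2 * (ε ^ 2 / 2)) hT0
    (u := fun t => ∫ ω, limitLoss M μ (W t ω) ∂P + b)
    (x := fun t => η / 2 * ∫ ω, ‖M.limitGrad μ (W t ω)‖ ^ 2 ∂P)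
    (by linarith [(abs_le.1 (hlow T)).1]) (by linarith [(abs_le.1 (hlow 0)).2])
    (fun t ht => by
      have h1 := r.setIntegral_descent S hb hη hCη t Set.univ
      simp only [setIntegral_univ] at h1
      rw [integral_sub (r.integrable_limitLoss S hb t) (r.integrable_limitLoss S hb (t + 1))] at h1
      have h2 : η / 2 * ∫ ω, sqError M μ W sample t ω ∂P ≤ η / 2 * (ε ^ 2 / 2) := by
        have := herr t ht
        gcongr
      linarith)
  refine ⟨t, htT, ?_⟩
  have hT' : (0 : ℝ) < T := by exact_mod_cast hT0
  have h1 : 2 * b / T ≤ η / 2 * (ε ^ 2 / 2) := by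
    rw [div_le_iff₀ hη] at hT
    rw [div_le_iff₀ hT']
    linarith
  have h2 : ∫ ω, ‖M.limitGrad μ (W t ω)‖ ^ 2 ∂P ≤ ε ^ 2 := by
    have : η / 2 * ∫ ω, ‖M.limitGrad μ (W t ω)‖ ^ 2 ∂P ≤ η / 2 * ε ^ 2 := by linarith
    exact le_of_mul_le_mul_left this (by positivity)
  have h3 := r.integrable_norm_limitGrad S t 2
  have h4 : Integrable (fun ω => ‖M.limitGrad μ (W t ω)‖) P := by
    simpa using r.integrable_norm_limitGrad S t 1
  -- The mean is bounded through the mean square by `2 ε x ≤ x² + ε²`.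
  calc ∫ ω, ‖M.limitGrad μ (W t ω)‖ ∂P
      ≤ ∫ ω, ((2 * ε)⁻¹ * ‖M.limitGrad μ (W t ω)‖ ^ 2 + ε / 2) ∂P := by
        refine integral_mono h4 ((h3.const_mul _).add (integrable_const _)) fun ω => ?_
        have : (2 * ε)⁻¹ * ‖M.limitGrad μ (W t ω)‖ ^ 2 + ε / 2 - ‖M.limitGrad μ (W t ω)‖ =
            (2 * ε)⁻¹ * (‖M.limitGrad μ (W t ω)‖ - ε) ^ 2 := by
          field_simp; ring
        have h5 : 0 ≤ (2 * ε)⁻¹ * (‖M.limitGrad μ (W t ω)‖ - ε) ^ 2 := by positivity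
        simp only
        linarith
    _ = (2 * ε)⁻¹ * ∫ ω, ‖M.limitGrad μ (W t ω)‖ ^ 2 ∂P + ε / 2 := by
        rw [integral_add (h3.const_mul _) (integrable_const _), integral_const_mul]
        simp
    _ ≤ (2 * ε)⁻¹ * ε ^ 2 + ε / 2 := by gcongr
    _ = ε := by field_simp; ring

/-- If the mean squared error of the minibatch gradient is at most `ε² / 2` for all coefficients at
which the limit gradient has norm more than `ε`, then the objective decreases in expectation by
`η ε² / 4` in every step before the end of the training. -/
theorem lintegral_trainingTime_le [IsProbabilityMeasure P]
    (r : MeasurableRun M μ ν η N B P W sample) (S : SmoothFamily M.pairLoss M.pairGrad b C)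
    (hb : 0 ≤ b) (hη : 0 < η) (hCη : (C : ℝ) * η ≤ 1 / 2) {ε : ℝ} (hε : 0 < ε)
    (herr : ∀ t w, ε < ‖M.limitGrad μ w‖ → ∫ s, ‖pairBatchGrad M w s - M.limitGrad μ w‖ ^ 2
      ∂(stepLaw M μ (N t) (B t)) ≤ ε ^ 2 / 2) :
    ∫⁻ ω, trainingTime M μ ε W ω ∂P ≤ ENNReal.ofReal (2 * b / (η / 4 * ε ^ 2)) := by
  have hlow : ∀ t ω, |limitLoss M μ (W t ω)| ≤ b := fun t ω => S.abs_integral_loss_le hb _ _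
  set D : Set (Coeffs p) := {w | ε < ‖M.limitGrad μ w‖} with hD
  have mD : MeasurableSet D := measurableSet_lt measurable_const (measurable_limitGrad S μ).norm
  refine lintegral_hittingTime_le (u := fun t ω => limitLoss M μ (W t ω) + b)
    (r := fun t ω => ‖M.limitGrad μ (W t ω)‖)
    (fun t => ((measurable_limitLoss S μ).comp (r.measurable_state S t)).add_const b)
    (fun t => ((measurable_limitGrad S μ).comp (r.measurable_state S t)).norm)
    (fun t ω => by linarith [(abs_le.1 (hlow t ω)).1])
    (fun t ω => by linarith [(abs_le.1 (hlow t ω)).2]) (by positivity) fun t => ?_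
  change η / 4 * ε ^ 2 * P.real {ω | ∀ s ≤ t, W s ω ∈ D} ≤
    ∫ ω in {ω | ∀ s ≤ t, W s ω ∈ D},
      (limitLoss M μ (W t ω) + b - (limitLoss M μ (W (t + 1) ω) + b)) ∂P
  have mE := r.measurableSet_stays S mD t
  have h1 := r.setIntegral_descent S hb hη hCη t {ω | ∀ s ≤ t, W s ω ∈ D}
  have h2 := r.setIntegral_sqError_le S mD (herr t)
  have h3 : ε ^ 2 * P.real {ω | ∀ s ≤ t, W s ω ∈ D} ≤
      ∫ ω in {ω | ∀ s ≤ t, W s ω ∈ D}, ‖M.limitGrad μ (W t ω)‖ ^ 2 ∂P := by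
    rw [mul_comm, ← smul_eq_mul, ← setIntegral_const]
    refine setIntegral_mono_on (integrable_const _).integrableOn
      (r.integrable_norm_limitGrad S t 2).integrableOn mE fun ω hω => ?_
    have : ε < ‖M.limitGrad μ (W t ω)‖ := hω t le_rfl
    gcongr
  simp only [add_sub_add_right_eq_sub]
  have h4 := mul_le_mul_of_nonneg_left h3 (by positivity : 0 ≤ η / 2)
  have h5 := mul_le_mul_of_nonneg_left h2 (by positivity : 0 ≤ η / 2)
  linarith

end MeasurableRun

end Run

/-! ### Training reaches small gradients -/

theorem exists_measureReal_norm_gt_le (ν : Measure (Coeffs p)) [IsProbabilityMeasure ν] {κ : ℝ}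
    (hκ : 0 < κ) : ∃ R : ℝ, ν.real {w | R < ‖w‖} ≤ κ := by
  have h := tendsto_measure_norm_gt_of_isTightMeasureSet (isTightMeasureSet_singleton (μ := ν))
  simp only [Set.mem_singleton_iff, iSup_iSup_eq_left] at h
  obtain ⟨R, hR⟩ := (h.eventually_le_const (ENNReal.ofReal_pos.2 hκ)).exists
  exact ⟨R, ENNReal.toReal_le_of_le_ofReal hκ.le hR⟩

section Sizes

variable (S : SmoothFamily M.pairLoss M.pairGrad b C) (μ : Measure (RootedGraph X A))
  [IsProbabilityMeasure μ] (hconv : LocallyConverges (fun N => μ.map (bfs N)) μ)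
  (hb : 0 ≤ b) {η ε : ℝ} (hη : 0 < η) (hCη : (C : ℝ) * η ≤ 1 / 2) (hε : 0 < ε)

include S hconv hb hη hCη hε

/-- Almost locality for every fixed `W` suffices for a small mean gradient: the law of the initial
coefficients is tight and the steps are bounded, so that up to the deterministic time horizon the
run stays in a compact set with high probability, where the error of the minibatch gradient is
uniformly small. -/
theorem exists_sizes_lintegral_limitGrad_le (ν : Measure (Coeffs p)) [IsProbabilityMeasure ν]
    (hloc : ∀ W, AlmostLocal μ (M.expectedLoss W) (M.expectedLoss W)) {K : ℝ} (hK0 : 0 ≤ K)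
    (hK : 8 * b / η ≤ K) :
    ∃ N₀ B₀ : ℕ, 0 < N₀ ∧ 0 < B₀ ∧ ∀ N B : ℕ → ℕ, (∀ t, N₀ ≤ N t) → (∀ t, B₀ ≤ B t) →
      ∀ {Ω : Type*} [MeasurableSpace Ω] (P : Measure Ω) [IsProbabilityMeasure P]
        (run : TrainingRun M μ ν η N B P),
        ∃ t : ℕ, (t : ℝ) ≤ K / ε ^ 2 ∧
          ∫⁻ ω, ‖M.limitGrad μ (run.W t ω)‖ₑ ∂P ≤ ENNReal.ofReal ε := by
  set T : ℕ := ⌊K / ε ^ 2⌋₊ + 1 with hT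
  set κ : ℝ := ε ^ 2 / (16 * ((C : ℝ) ^ 2 + 1)) with hκ
  obtain ⟨R, hR⟩ := exists_measureReal_norm_gt_le ν (κ := κ) (by positivity)
  obtain ⟨N₀, B₀, hN₀, hB₀, herr⟩ := exists_integral_error_le S μ
    (D := Metric.closedBall 0 (R + η * C * T)) (D' := Metric.closedBall 0 (R + η * C * T + 1))
    (fun W hW h hh => by
      rw [Metric.mem_closedBall, dist_zero_right] at hW ⊢
      exact (norm_add_le _ _).trans (add_le_add hW hh))
    (fun δ hδ => tendsto_lossGap_of_isCompact S hconv hloc (isCompact_closedBall _ _) hδ)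
    (δ := ε ^ 2 / 4) (by positivity)
  refine ⟨N₀, B₀, hN₀, hB₀, fun N B hN hB Ω _ P _ run => ?_⟩
  obtain ⟨W, sample, r, hae⟩ := run.exists_measurableRun
  obtain ⟨t, htT, ht⟩ := r.exists_integral_norm_limitGrad_le S hb hη hCη hε (T := T)
    (Nat.succ_pos _) (by
      have h1 := (Nat.lt_floor_add_one (K / ε ^ 2)).le
      rw [div_le_iff₀ (by positivity)] at h1
      rw [hT]
      push_cast
      exact hK.trans h1)
    (fun t ht => by
      refine (r.integral_sqError_le S hη.le (by positivity) ht.le hR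
        (herr (N t) (hN t) (B t) (hB t))).trans ?_
      have : 4 * (C : ℝ) ^ 2 * κ ≤ ε ^ 2 / 4 := by
        rw [hκ, mul_div_assoc', div_le_iff₀ (by positivity)]
        nlinarith [sq_nonneg ε]
      linarith)
  refine ⟨t, ?_, ?_⟩
  · exact (Nat.le_floor_iff (by positivity)).1 (Nat.lt_succ_iff.1 htT)
  · have hint : Integrable (fun ω => M.limitGrad μ (W t ω)) P :=
      Integrable.of_bound
        ((measurable_limitGrad S μ).comp (r.measurable_state S t)).aestronglyMeasurable C
        (ae_of_all _ fun ω => norm_limitGrad_le S μ _)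
    rw [lintegral_congr_ae (hae.mono fun ω hω => by rw [hω t]),
      ← ofReal_integral_norm_eq_lintegral_enorm hint]
    exact ENNReal.ofReal_le_ofReal ht

/-- The training time is not bounded in advance, so the error of the minibatch gradient has to be
small uniformly over all coefficients. -/
theorem exists_sizes_lintegral_trainingTime_le
    (hunif : UniformlyAlmostLocal μ M.expectedLoss M.expectedLoss) (ν : Measure (Coeffs p)) :
    ∃ N₀ B₀ : ℕ, ∀ N B : ℕ → ℕ, (∀ t, N₀ ≤ N t) → (∀ t, B₀ ≤ B t) →
      ∀ {Ω : Type*} [MeasurableSpace Ω] (P : Measure Ω) [IsProbabilityMeasure P]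
        (run : TrainingRun M μ ν η N B P),
        ∫⁻ ω, trainingTime M μ ε run.W ω ∂P ≤ ENNReal.ofReal (8 * b / η / ε ^ 2) := by
  obtain ⟨N₀, B₀, -, -, herr⟩ := exists_integral_error_le S μ
    (D := Set.univ) (D' := Set.univ) (fun _ _ _ _ => Set.mem_univ _)
    (fun δ hδ => tendsto_lossGap_univ S hconv hunif hδ)
    (δ := ε ^ 2 / 2) (by positivity)
  refine ⟨N₀, B₀, fun N B hN hB Ω _ P _ run => ?_⟩
  obtain ⟨W, sample, r, hae⟩ := run.exists_measurableRun
  have hcongr : ∀ᵐ ω ∂P, trainingTime M μ ε run.W ω = trainingTime M μ ε W ω :=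
    hae.mono fun ω hω => by simp only [trainingTime, hω]
  rw [lintegral_congr_ae hcongr]
  refine (r.lintegral_trainingTime_le S hb hη hCη hε fun t w _ =>
    herr (N t) (hN t) (B t) (hB t) w (Set.mem_univ w)).trans (le_of_eq ?_)
  congr 1
  field_simp
  ring

end Sizes

end LocalGNN

theorem mainTheorem2 {X A : Type*} [MeasurableSpace X] [MeasurableSpace A] {p : ℕ}
    (M : LocalGNN.SamplingGNN X A p)
    (μ : MeasureTheory.Measure (LocalGNN.RootedGraph X A)) [MeasureTheory.IsProbabilityMeasure μ]
    (ν : MeasureTheory.Measure (LocalGNN.Coeffs p)) [MeasureTheory.IsProbabilityMeasure ν]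
    (b : ℝ) (C : NNReal)
    (hmeas : ∀ W c, Measurable fun g => M.nodeLoss W g c)
    (hreg : M.RegularLoss b C)
    (hloc : ∀ W, LocalGNN.AlmostLocal μ (M.expectedLoss W) (M.expectedLoss W))
    (hconv : LocalGNN.LocallyConverges (fun N => μ.map (LocalGNN.RootedGraph.bfs N)) μ) :
    ∃ η : ℝ, 0 < η ∧ ∃ K : ℝ, 0 < K ∧ ∀ ε : ℝ, 0 < ε →
      ∃ Nε Bε : ℕ, 0 < Nε ∧ 0 < Bε ∧
        ∀ N B : ℕ → ℕ, (∀ t, Nε ≤ N t) → (∀ t, Bε ≤ B t) →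
          ∀ {Ω : Type*} [MeasurableSpace Ω] (P : MeasureTheory.Measure Ω)
            [MeasureTheory.IsProbabilityMeasure P]
            (run : LocalGNN.TrainingRun M μ ν η N B P),
            (∃ t : ℕ, (t : ℝ) ≤ K / ε ^ 2 ∧
              ∫⁻ ω, ‖M.limitGrad μ (run.W t ω)‖ₑ ∂P ≤ ENNReal.ofReal ε) ∧
            (LocalGNN.UniformlyAlmostLocal μ M.expectedLoss M.expectedLoss →
              ∫⁻ ω, LocalGNN.trainingTime M μ ε run.W ω ∂P ≤ ENNReal.ofReal (K / ε ^ 2)) := by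
  obtain ⟨g⟩ := μ.nonempty_of_neZero
  have hb : 0 ≤ b := (abs_nonneg _).trans (hreg.bounded 0 g ∅ fun e he => by simp at he)
  have S := hreg.smoothFamily hb hmeas
  have hC : (0 : ℝ) ≤ C := C.2
  have hη : (0 : ℝ) < 1 / (2 * (C + 1)) := by positivity
  have hCη : (C : ℝ) * (1 / (2 * (C + 1))) ≤ 1 / 2 := by
    rw [mul_one_div, div_le_iff₀ (by positivity)]
    linarith
  -- With this learning rate the quadratic error `C ‖h‖²` of the expansion along a step `h = -η g` is
  -- at most `η / 2 · ‖g‖²`. The summand `1` only makes `K` positive when `b = 0`.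
  refine ⟨1 / (2 * (C + 1)), hη, 8 * b / (1 / (2 * (C + 1))) + 1, by positivity, fun ε hε => ?_⟩
  obtain ⟨N₁, B₁, hN₁, hB₁, h₁⟩ := LocalGNN.exists_sizes_lintegral_limitGrad_le S μ hconv hb hη hCη
    hε ν hloc (K := 8 * b / (1 / (2 * (C + 1))) + 1) (by positivity) (by linarith)
  by_cases hunif : LocalGNN.UniformlyAlmostLocal μ M.expectedLoss M.expectedLoss
  · obtain ⟨N₂, B₂, h₂⟩ := LocalGNN.exists_sizes_lintegral_trainingTime_le S μ hconv hb hη hCη hε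
      hunif ν
    refine ⟨max N₁ N₂, max B₁ B₂, lt_max_of_lt_left hN₁, lt_max_of_lt_left hB₁,
      fun N B hN hB Ω _ P _ run => ⟨?_, fun _ => ?_⟩⟩
    · exact h₁ N B (fun t => (le_max_left _ _).trans (hN t))
        (fun t => (le_max_left _ _).trans (hB t)) P run
    · refine (h₂ N B (fun t => (le_max_right _ _).trans (hN t))
        (fun t => (le_max_right _ _).trans (hB t)) P run).trans (ENNReal.ofReal_le_ofReal ?_)
      gcongr
      linarith
  · exact ⟨N₁, B₁, hN₁, hB₁, fun N B hN hB Ω _ P _ run =>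
      ⟨h₁ N B hN hB P run, fun h => absurd h hunif⟩⟩
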